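/- Let $P\in\mathbb{C}[z,w]$ and let $\Gamma\subseteq\widehat{\mathbb{C}}\times\widehat{\mathbb{C}}$ be the algebraic curve $P(z,w)=0$ (respectively $P(\overline z,w)=0$), i.e. the zero set of the bihomogenization of $P$ of bidegree $(\deg_z P,\deg_w P)$. Let $F$ be the holomorphic (respectively antiholomorphic) correspondence $F(z)=\{w:(z,w)\in\Gamma\}$, with iterates $F^n$ and inverse correspondence $F^{-1}(w)=\{z:(z,w)\in\Gamma\}$. Let $\mathcal{CV}_{F^{-1}}$ be the set of points $\pi_z(a)$, where $a\in\Gamma$ is a point such that, in every neighbourhood of $a$, the first projection $\pi_z$ is not injective on some local irreducible component of $\Gamma$ at $a$, and let $\mathcal{PC}_{F^{-1}}=\overline{\bigcup_{i\ge 0}F^{-i}(\mathcal{CV}_{F^{-1}})}$. If $x\in\widehat{\mathbb{C}}$ has a connected open neighbourhood $U$ on which all branches of all $F^n$ are defined (that is, for each $n$ there are finitely many pairwise distinct (anti)holomorphic maps $f_{n,1},\dots,f_{n,M_n}\colon U\to\widehat{\mathbb{C}}$ with $F^n(y)=\{f_{n,j}(y):1\le j\le M_n\}$ for all $y\in U$),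 put $P_s(x)=\sum_{n\ge0}\sum_{j=1}^{M_n}|Df_{n,j}(x)|^s$ for $s>0$, where $|D\cdot|$ is the absolute value of the derivative in the spherical metric; otherwise put $P_s(x)=+\infty$. Let $\delta_{\mathrm{crit}}(x)=\inf\{s>0:P_s(x)<+\infty\}\in[0,+\infty]$, with $\inf\emptyset=+\infty$. Let $S\subsetneq\widehat{\mathbb{C}}$ be closed, and suppose that $F$ is invariantly inverse-like on $S$: $F(S)\subseteq S$, and for each $w\in F(S)$ there is a unique $z\in S$ with $z\in F^{-1}(w)$. Let $g=g_{F,S}\colon F(S)\to S$, $g(w)=z$. Suppose that $g$ has an attracting periodic orbit $z_1,\dots,z_n$ of period $n$ (that is, $|D(g^n)(z_j)|<1$; the value $0$ is allowed) in the interior of $F(S)$. Let $\mathcal{A}=\bigcup_{j=1}^n\mathcal{A}_j$ be its immediate basin of attraction, where $\mathcal{A}_j$ is the largest connected open set containing $z_j$ such that, for each $y\in\mathcal{A}_j$, all iterates $g^k(y)$, $k\ge0$, are defined and $(g^n)^k(y)\to z_j$ as $k\to+\infty$. Then $1\le\delta_{\mathrm{crit}}(x)\le 2$ for each $x\in\mathcal{A}\smallsetminus\mathcal{PC}_{F^{-1}}$.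 -/

import Mathlib

open Set Filter Topology
open scoped ENNReal

noncomputable section

namespace HolCorr

/-! ### The Riemann sphere: charts, holomorphic maps, spherical derivative -/

/-- The Riemann sphere `ℂ ∪ {∞}`. -/
abbrev RSphere : Type := OnePoint ℂ

/-- The standard coordinate used near the point `a`: the identity `z ↦ z` if `a` is finite, and
`z ↦ 1/z` (with `∞ ↦ 0`) if `a = ∞`. (The value `0` of the first chart at `∞` is never used:
`∞` is outside the domain of that chart.) -/
def coordAt (a : RSphere) : RSphere → ℂ :=
  a.elim (fun z => z.elim 0 fun t => t⁻¹) (fun _ z => z.elim 0 fun t => t)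

/-- The inverse of the coordinate `coordAt a`. -/
def ofCoord (a : RSphere) : ℂ → RSphere :=
  a.elim (fun t => open Classical in if t = 0 then OnePoint.infty else ((t⁻¹ : ℂ) : RSphere))
    (fun _ t => (t : RSphere))

/-- A sphere-valued function `γ` of one complex variable is holomorphic at `t₀`. -/
def HolomorphicCurveAt (γ : ℂ → RSphere) (t₀ : ℂ) : Prop :=
  ContinuousAt γ t₀ ∧ AnalyticAt ℂ (fun t => coordAt (γ t₀) (γ t)) t₀

/-- A self-map of the sphere is holomorphic at (hence near) `a`. -/
def HolomorphicAt (f : RSphere → RSphere) (a : RSphere) : Prop :=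
  HolomorphicCurveAt (fun t => f (ofCoord a t)) (coordAt a a)

/-- Complex conjugation on the sphere, fixing `∞`. -/
def conj : RSphere → RSphere := OnePoint.map (starRingEnd ℂ)

/-- A self-map of the sphere is antiholomorphic at `a`: its conjugate is holomorphic there. -/
def AntiholomorphicAt (f : RSphere → RSphere) (a : RSphere) : Prop :=
  HolomorphicAt (fun z => conj (f z)) a

/-- The expression of `f` near `a` in the standard coordinates at `a` and at `f a`. -/
def localRep (f : RSphere → RSphere) (a : RSphere) : ℂ → ℂ :=
  fun t => coordAt (f a) (f (ofCoord a t))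

/-- `|Df|(a)`: the absolute value of the total derivative of `f` at `a` in the spherical metric
`2|dz|/(1+|z|²)`. The metric has this same expression in the coordinate `1/z`. The operator norm
of the real derivative is `|f'|` for holomorphic and for antiholomorphic maps. -/
def sphericalDeriv (f : RSphere → RSphere) (a : RSphere) : ℝ :=
  ‖fderiv ℝ (localRep f a) (coordAt a a)‖ * (1 + ‖coordAt a a‖ ^ 2) /
    (1 + ‖coordAt (f a) (f a)‖ ^ 2)

/-- `f` is differentiable (in the real sense) at `a` as a map of the sphere. -/
def SphereDifferentiableAt (f : RSphere → RSphere) (a : RSphere) : Prop :=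
  ContinuousAt f a ∧ DifferentiableAt ℝ (localRep f a) (coordAt a a)

/-! ### Algebraic curves on `RSphere × RSphere` -/

/-- Homogeneous coordinates of a point of the sphere: `[z : 1]`, and `[1 : 0]` for `∞`. -/
def homCoord (z : RSphere) : ℂ × ℂ :=
  z.elim (1, 0) fun t => (t, 1)

/-- The algebraic curve `P(z, w) = 0` in `RSphere × RSphere`: the zero set of the
bihomogenization of `P` (variable `0` is `z`, variable `1` is `w`), of bidegree
`(deg_z P, deg_w P)`. -/
def curve (P : MvPolynomial (Fin 2) ℂ) : Set (RSphere × RSphere) :=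
  {p | ∑ m ∈ P.support, P.coeff m *
      ((homCoord p.1).1 ^ m 0 * (homCoord p.1).2 ^ (P.degreeOf 0 - m 0)) *
      ((homCoord p.2).1 ^ m 1 * (homCoord p.2).2 ^ (P.degreeOf 1 - m 1)) = 0}

/-- `γ` parametrizes a local irreducible component of the curve `Γ` at `a`: it is an injective
holomorphic germ at `0` with values in `Γ` and with `γ 0 = a`. (The local irreducible components
of an analytic curve at a point are exactly the images of such germs.) -/
structure IsLocalComponent (Γ : Set (RSphere × RSphere)) (a : RSphere × RSphere)
    (γ : ℂ → RSphere × RSphere) : Prop where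
  map_zero : γ 0 = a
  holomorphic_fst : HolomorphicCurveAt (fun t => (γ t).1) 0
  holomorphic_snd : HolomorphicCurveAt (fun t => (γ t).2) 0
  mem : ∀ᶠ t in 𝓝 (0 : ℂ), γ t ∈ Γ
  injective : ∃ V ∈ 𝓝 (0 : ℂ), InjOn γ V

/-- The ramification points of the first projection: the points `a` of `Γ` such that on some local
irreducible component of `Γ` at `a` the first projection is not injective, however small the
neighbourhood of `a`. -/
def ramificationFst (Γ : Set (RSphere × RSphere)) : Set (RSphere × RSphere) :=
  {a | ∃ γ, IsLocalComponent Γ a γ ∧ ∀ V ∈ 𝓝 (0 : ℂ), ¬ InjOn (fun t => (γ t).1) V}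

/-! ### Correspondences -/

/-- A holomorphic (`anti = false`) or antiholomorphic (`anti = true`) correspondence of the
sphere, given by the equation `P(z, w) = 0`, respectively `P(z̄, w) = 0`. -/
structure Correspondence where
  poly : MvPolynomial (Fin 2) ℂ
  anti : Bool

namespace Correspondence

variable (F : Correspondence)

/-- The identity for a holomorphic, complex conjugation for an antiholomorphic correspondence. -/
def twist (z : RSphere) : RSphere := if F.anti then conj z else z

/-- The graph `{(z, w) : P(z, w) = 0}`, respectively `{(z, w) : P(z̄, w) = 0}`. -/
def graph : Set (RSphere × RSphere) := {p | (F.twist p.1, p.2) ∈ curve F.poly}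

/-- `F(A)`, the union of the sets `F(z) = {w : (z, w) ∈ graph}` for `z ∈ A`. -/
def image (A : Set RSphere) : Set RSphere := {w | ∃ z ∈ A, (z, w) ∈ F.graph}

/-- `F⁻¹(B)`, where `F⁻¹` is the inverse correspondence. -/
def preimage (B : Set RSphere) : Set RSphere := {z | ∃ w ∈ B, (z, w) ∈ F.graph}

/-- `Fⁿ(z)`. -/
def iter (n : ℕ) (z : RSphere) : Set RSphere := F.image^[n] {z}

/-- The critical values of `F⁻¹`: the first coordinates of the ramification points of the first
projection of the graph. (In the antiholomorphic case the graph is carried to an algebraic curve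
by conjugation of the first coordinate.) -/
def criticalValuesInv : Set RSphere :=
  {z | ∃ w, (F.twist z, w) ∈ ramificationFst (curve F.poly)}

/-- The postcritical set of `F⁻¹`: the closure of `⋃_{i ≥ 0} F⁻ⁱ(CV)`, where `CV` is the set of
critical values of `F⁻¹`. -/
def postcriticalInv : Set RSphere :=
  closure (⋃ i : ℕ, F.preimage^[i] F.criticalValuesInv)

/-! ### Branches, Poincaré series, critical exponent -/

/-- `f` is holomorphic on `U`, or antiholomorphic if `F` is antiholomorphic and `n` is odd: this
is the kind of map that a branch of `Fⁿ` is. -/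
def RegularOn (n : ℕ) (f : RSphere → RSphere) (U : Set RSphere) : Prop :=
  ∀ a ∈ U, if F.anti ∧ Odd n then AntiholomorphicAt f a else HolomorphicAt f a

/-- All branches of `Fⁿ` are defined on `U`: the list `f 0, …, f (M - 1)` of the (pairwise
different) branches. -/
structure Branches (n : ℕ) (U : Set RSphere) where
  M : ℕ
  f : Fin M → RSphere → RSphere
  regular : ∀ j, F.RegularOn n (f j) U
  iter_eq : ∀ z ∈ U, F.iter n z = range fun j => f j z
  distinct : ∀ i j, EqOn (f i) (f j) U → i = j

/-- The Poincaré series `P_s(x) = ∑ₙ ∑ⱼ |Df_{n,j}(x)|^s`, where `f_{n,j}` are the branches of `Fⁿ`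
on a connected open neighbourhood `U` of `x` on which all branches of all `Fⁿ` are defined.
By the identity theorem, the sum does not depend on `U` or on the labelling of the branches, so
the infimum is over equal values; if there is no such `U`, it is the infimum of the empty set,
`P_s(x) = ∞`. -/
def poincareSeries (s : ℝ) (x : RSphere) : ℝ≥0∞ :=
  ⨅ (U : Set RSphere) (_ : IsOpen U ∧ IsConnected U ∧ x ∈ U) (B : ∀ n, F.Branches n U),
    ∑' n, ∑ j, ENNReal.ofReal (sphericalDeriv ((B n).f j) x) ^ s

/-- The critical exponent `δ_crit(x) = inf {s > 0 : P_s(x) < ∞} ∈ [0, ∞]`, with `inf ∅ = ∞`. -/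
def criticalExponent (x : RSphere) : ℝ≥0∞ :=
  sInf {δ | ∃ s : ℝ, 0 < s ∧ F.poincareSeries s x < ⊤ ∧ δ = ENNReal.ofReal s}

/-! ### Invariantly inverse-like correspondences and immediate basins -/

/-- `F` is invariantly inverse-like on `S`. -/
def InvariantlyInverseLike (S : Set RSphere) : Prop :=
  F.image S ⊆ S ∧ ∀ w ∈ F.image S, ∃! z, z ∈ S ∧ (z, w) ∈ F.graph

/-- The map `g : F(S) → S` which sends `w` to the (unique, if `F` is invariantly inverse-like on
`S`) point of `S ∩ F⁻¹(w)`. Outside `F(S)` the value is irrelevant. -/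
def inverseMap (S : Set RSphere) (w : RSphere) : RSphere :=
  open Classical in if h : w ∈ F.image S then h.choose else w

/-- `z` belongs to an attracting periodic orbit of `g : F(S) → S` of period `n` that lies in the
interior of `F(S)`: `gⁿ(z) = z` and `|D(gⁿ)(z)| < 1`. -/
structure IsAttractingPeriodic (S : Set RSphere) (n : ℕ) (z : RSphere) : Prop where
  pos : 0 < n
  periodic : Function.IsPeriodicPt (F.inverseMap S) n z
  mem_interior : ∀ j, (F.inverseMap S)^[j] z ∈ interior (F.image S)
  differentiable : SphereDifferentiableAt (F.inverseMap S)^[n] z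
  attracting : sphericalDeriv (F.inverseMap S)^[n] z < 1

/-- The points `y` such that all iterates `g^k(y)` are defined and `(gⁿ)^k(y) → p`. -/
def basin (S : Set RSphere) (n : ℕ) (p : RSphere) : Set RSphere :=
  {y | (∀ k, (F.inverseMap S)^[k] y ∈ F.image S) ∧
    Tendsto (fun k => ((F.inverseMap S)^[n])^[k] y) atTop (𝓝 p)}

/-- The largest connected open set which contains `p` and is contained in `basin S n p`. -/
def basinComponent (S : Set RSphere) (n : ℕ) (p : RSphere) : Set RSphere :=
  ⋃₀ {V | IsOpen V ∧ IsConnected V ∧ p ∈ V ∧ V ⊆ F.basin S n p}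

/-- The immediate basin of attraction of the periodic orbit `z, g(z), …, g^(n-1)(z)`. -/
def immediateBasin (S : Set RSphere) (n : ℕ) (z : RSphere) : Set RSphere :=
  ⋃ j ∈ Finset.range n, F.basinComponent S n ((F.inverseMap S)^[j] z)

end Correspondence

end HolCorr

end

/-! The set S misses a finite point b. A rotation carrying infinity to b turns g into a map from a
compact plane set L to a compact plane set K, holomorphic up to conjugation inside L
(`PlanarSystem`, `PlanarSystem.exists_models`). Branches of F^k are inverse branches of g^k. Up to
bounded spherical factors, P_s(x) is therefore the sum over k and over v with g^k(v) = x of w^s,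
where w = |(g^k)'(v)|⁻¹ is `wt`. Off the postcritical set these branches are injective holomorphic
maps on discs (up to conjugation), so the Koebe theorem controls their distortion.

Upper bound (`tsum_wt_sq_lt_top`): the attracting point is postcritical, so x differs from it, and a
small disc at x never meets its forward images. The images of this disc under all inverse branches
of all iterates are then disjoint. Each contains a disc of radius comparable to w, and all lie in
the compact set K. Comparing areas gives convergence at s = 2.

Lower bound (`exists_le_wtSum`): fix a small circle around the attracting point p. For each multiple
Nk of the period, the points that g^(Nk) sends inside the circle contain a fixed disc around p and
form a bounded set, so every vertical line close to p meets the preimage of the circle. That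
preimage is covered by finitely many families of Koebe discs with radii comparable to w, so the sum
of w over a fibre is bounded below independently of k. The postcritical set is countable in the
basin component, so estimates transfer along chains of discs from the circle to x
(`IsBasin.comparable`). As w is bounded, w^s dominates a multiple of w when s < 1; every level Nk
then contributes at least a fixed amount, and the series diverges. -/

noncomputable section

namespace HolCorr

/-! ### Koebe-type distortion estimates -/

open Metric in
/-- A holomorphic function with nonvanishing derivative on an open set which is injective there has
a continuous inverse. -/
theorem continuousOn_of_leftInvOn_of_deriv_ne_zero {f ψ : ℂ → ℂ} {U T : Set ℂ} (hU : IsOpen U)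
    (hd : DifferentiableOn ℂ f U) (hne : ∀ z ∈ U, deriv f z ≠ 0)
    (hψ : ∀ z ∈ U, ψ (f z) = z) (hT : T ⊆ f '' U) : ContinuousOn ψ T := by
  intro u hu
  obtain ⟨z, hz, rfl⟩ := hT hu
  have hs : HasStrictDerivAt f (deriv f z) z :=
    (hd.analyticAt (hU.mem_nhds hz)).hasStrictDerivAt
  refine ContinuousAt.continuousWithinAt ?_
  rw [ContinuousAt, hψ z hz, ← hs.map_nhds_eq (hne z hz)]
  refine tendsto_map'_iff.2 (tendsto_id.congr' ?_)
  filter_upwards [hU.mem_nhds hz] with y hy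
  simp [hψ y hy]

open Metric in
/-- A weak form of the Koebe distortion theorem. -/
theorem exists_ball_subset_image_and_norm_sub_le {f : ℂ → ℂ} {c : ℂ} {r : ℝ} (hr : 0 < r)
    (hd : DifferentiableOn ℂ f (ball c r)) (hinj : InjOn f (ball c r))
    (hne : ∀ z ∈ ball c r, deriv f z ≠ 0) (hb : Bornology.IsBounded (f '' ball c r)) :
    ∃ ρ > 0, ρ ≤ r * ‖deriv f c‖ ∧ ball (f c) ρ ⊆ f '' ball c r ∧
      ∀ z ∈ ball c (r / 12), ‖f z - f c‖ ≤ 24 * ρ := by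
  have hc : c ∈ ball c r := mem_ball_self hr
  have hopen : IsOpen (f '' ball c r) := by
    rw [isOpen_iff_mem_nhds]
    rintro _ ⟨z, hz, rfl⟩
    have hs : HasStrictDerivAt f (deriv f z) z :=
      (hd.analyticAt (isOpen_ball.mem_nhds hz)).hasStrictDerivAt
    rw [← hs.map_nhds_eq (hne z hz)]
    exact image_mem_map (isOpen_ball.mem_nhds hz)
  have hcne : ((f '' ball c r)ᶜ).Nonempty := by
    rw [nonempty_compl]
    intro h
    rw [h] at hb
    exact NormedSpace.unbounded_univ ℂ ℂ hb
  obtain ⟨w, hw, hwd⟩ := hopen.isClosed_compl.exists_infDist_eq_dist hcne (f c)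
  have hfc : f c ∈ f '' ball c r := mem_image_of_mem f hc
  have hρ : 0 < dist (f c) w := by
    rw [dist_pos]
    rintro h
    exact hw (h ▸ hfc)
  have hball : ball (f c) (dist (f c) w) ⊆ f '' ball c r := by
    rw [← hwd]
    simpa using ball_infDist_compl_subset (s := f '' ball c r) (x := f c)
  have hwf : ∀ z ∈ ball c r, f z ≠ w := fun z hz h => hw ⟨z, hz, h⟩
  set ρ := dist (f c) w with hρdef
  have hwc : w - f c ≠ 0 := sub_ne_zero.2 (hwf c hc).symm
  have hwn : ‖w - f c‖ = ρ := by rw [hρdef, dist_comm, dist_eq_norm]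
  set ψ : ℂ → ℂ := Function.invFunOn f (ball c r) with hψdef
  have hψ : ∀ z ∈ ball c r, ψ (f z) = z := fun z hz => hinj.leftInvOn_invFunOn hz
  have hψc : ContinuousOn ψ (ball (f c) ρ) :=
    continuousOn_of_leftInvOn_of_deriv_ne_zero isOpen_ball hd hne hψ hball
  have hψm : ∀ u ∈ ball (f c) ρ, ψ u ∈ ball c r ∧ f (ψ u) = u := by
    intro u hu
    obtain ⟨z, hz, rfl⟩ := hball hu
    rw [hψ z hz]
    exact ⟨hz, rfl⟩
  have hψd : ∀ u ∈ ball (f c) ρ, HasDerivAt ψ (deriv f (ψ u))⁻¹ u := by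
    intro u hu
    have hm := hψm u hu
    refine HasDerivAt.of_local_left_inverse (hψc.continuousAt (isOpen_ball.mem_nhds hu))
      (hd.differentiableAt (isOpen_ball.mem_nhds hm.1)).hasDerivAt (hne _ hm.1) ?_
    filter_upwards [isOpen_ball.mem_nhds hu] with y hy using (hψm y hy).2
  refine ⟨ρ, hρ, ?_, hball, ?_⟩
  -- Schwarz for the inverse `ψ`, which maps the disc of radius `ρ` into that of radius `r`.
  · have h1 : ‖deriv ψ (f c)‖ ≤ r / ρ := by
      refine Complex.norm_deriv_le_div_of_mapsTo_ball
        (fun u hu => (hψd u hu).differentiableAt.differentiableWithinAt) ?_ hρ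
      intro u hu
      rw [hψ c hc]
      exact ball_subset_closedBall (hψm u hu).1
    rw [(hψd (f c) (mem_ball_self hρ)).deriv, hψ c hc, norm_inv, le_div_iff₀ hρ] at h1
    have h2 : 0 < ‖deriv f c‖ := norm_pos_iff.2 (hne c hc)
    rwa [inv_mul_le_iff₀ h2, mul_comm] at h1
  -- a holomorphic square root
  set q : ℂ → ℂ := fun u => 1 - (u - f c) / (w - f c) with hq
  have hq0 : ∀ z ∈ ball c r, q (f z) ≠ 0 := by
    intro z hz h
    apply hwf z hz
    simp only [hq] at h
    field_simp at h
    linear_combination -h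
  have hsc : IsSimplyConnected (ball c r) := by
    have := contractibleSpace_ball (x := c) hr
    exact (inferInstance : SimplyConnectedSpace (ball c r))
  have hqf : DifferentiableOn ℂ (fun z => q (f z)) (ball c r) := by
    simp only [hq]
    exact (((hd.sub_const _).div_const _).const_sub _)
  obtain ⟨h₀, hh₀c, hh₀⟩ := Complex.exists_continuousOn_pow_eq hsc isOpen_ball
    (g := fun z => q (f z)) hqf.continuousOn
    (by rintro ⟨z, hz, h⟩; exact hq0 z hz h) two_ne_zero
  have h₀c : h₀ c ^ 2 = 1 := by rw [hh₀ c]; simp [hq]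
  obtain ⟨h, hhc, hh, hc1⟩ : ∃ h : ℂ → ℂ, ContinuousOn h (ball c r) ∧
      (∀ z, h z ^ 2 = q (f z)) ∧ h c = 1 := by
    rcases mul_self_eq_one_iff.1 ((sq _).symm.trans h₀c) with h1 | h1
    · exact ⟨h₀, hh₀c, hh₀, h1⟩
    · exact ⟨fun z => -h₀ z, hh₀c.neg, fun z => by simp [hh₀ z], by simp [h1]⟩
  have hhd : DifferentiableOn ℂ h (ball c r) := by
    intro z hz
    have hz' := isOpen_ball.mem_nhds hz
    have hhz : h z ≠ 0 := by
      intro h0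
      apply hq0 z hz
      rw [← hh z, h0]; simp
    refine DifferentiableAt.differentiableWithinAt ?_
    have hcont : ContinuousAt h z := hhc.continuousAt hz'
    have hsq : HasStrictDerivAt (fun y : ℂ => y ^ 2) (2 * h z) (h z) := by
      simpa using hasStrictDerivAt_pow 2 (h z)
    have hm : (2 * h z) ≠ 0 := mul_ne_zero two_ne_zero hhz
    let e := hsq.localInverse (fun y : ℂ => y ^ 2) _ _ hm
    have he : HasStrictDerivAt e (2 * h z)⁻¹ ((h z) ^ 2) := hsq.to_localInverse hm
    have hev : ∀ᶠ y in 𝓝 (h z), e (y ^ 2) = y := hsq.hasStrictFDerivAt_equiv hm |>.eventually_left_inverse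
    have hee : (fun y => e (q (f y))) =ᶠ[𝓝 z] h := by
      filter_upwards [hcont.eventually hev] with y hy
      rw [← hh y, hy]
    refine DifferentiableAt.congr_of_eventuallyEq ?_ hee.symm
    have he' : DifferentiableAt ℂ e (q (f z)) := by
      rw [← hh z]; exact he.hasDerivAt.differentiableAt
    exact he'.comp z (hqf.differentiableAt hz')
  -- `h` omits a disc around `-1`
  have homit : ∀ z ∈ ball c r, 2 / 5 ≤ ‖h z + 1‖ := by
    intro z hz
    -- If |h + 1| < 2/5, then |h² - 1| < (2/5)(2/5 + 2) < 1, so `f z` lies in the disc of radius `ρ`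
    -- about `f c`. There Re q > 0, so Re h∘ψ never vanishes and stays positive as at the centre;
    -- but Re h(z) < 0.
    by_contra! hlt
    have hq1 : ‖q (f z) - 1‖ < 1 := by
      rw [← hh z]
      have e1 : h z ^ 2 - 1 = (h z + 1) * ((h z + 1) - 2) := by ring
      rw [e1, norm_mul]
      have e2 : ‖(h z + 1) - 2‖ ≤ ‖h z + 1‖ + 2 := by
        simpa using norm_sub_le (h z + 1) 2
      nlinarith [norm_nonneg (h z + 1)]
    have hfz : f z ∈ ball (f c) ρ := by
      rw [mem_ball, dist_eq_norm]
      have e3 : q (f z) - 1 = -((f z - f c) / (w - f c)) := by simp only [hq]; ring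
      rw [e3, norm_neg, norm_div, hwn, div_lt_one hρ] at hq1
      exact hq1
    have hcontH : ContinuousOn (fun u => (h (ψ u)).re) (ball (f c) ρ) :=
      Complex.continuous_re.comp_continuousOn
        (hhc.comp hψc fun u hu => (hψm u hu).1)
    have hpre : IsPreconnected ((fun u => (h (ψ u)).re) '' ball (f c) ρ) :=
      (convex_ball _ _).isPreconnected.image _ hcontH
    have hmem1 : (1 : ℝ) ∈ (fun u => (h (ψ u)).re) '' ball (f c) ρ :=
      ⟨f c, mem_ball_self hρ, by simp [hψ c hc, hc1]⟩
    have hmem2 : (h z).re ∈ (fun u => (h (ψ u)).re) '' ball (f c) ρ :=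
      ⟨f z, hfz, by simp [hψ z hz]⟩
    have hre : (h z).re < 0 := by
      have := (Complex.abs_re_le_norm (h z + 1)).trans_lt hlt
      simp only [Complex.add_re, Complex.one_re] at this
      have := (abs_lt.1 this).2
      linarith
    obtain ⟨u, hu, hu0⟩ := hpre.ordConnected.out hmem2 hmem1 ⟨hre.le, zero_le_one⟩
    have hqu : q u = h (ψ u) ^ 2 := by rw [hh, (hψm u hu).2]
    have hu0' : (h (ψ u)).re = 0 := hu0
    have hqre : (q u).re ≤ 0 := by
      rw [hqu, pow_two, Complex.mul_re, hu0']
      nlinarith [mul_self_nonneg (h (ψ u)).im]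
    have hqu1 : ‖q u - 1‖ < 1 := by
      have e3 : q u - 1 = -((u - f c) / (w - f c)) := by simp only [hq]; ring
      rw [e3, norm_neg, norm_div, hwn, div_lt_one hρ, ← dist_eq_norm]
      exact hu
    have := (Complex.abs_re_le_norm (q u - 1)).trans_lt hqu1
    simp only [Complex.sub_re, Complex.one_re] at this
    have := (abs_lt.1 this).1
    linarith
  -- Schwarz lemma
  intro z hz
  have hzr : z ∈ ball c r := ball_subset_ball (by linarith) hz
  have hne1 : ∀ y ∈ ball c r, h y + 1 ≠ 0 := fun y hy h0 => by
    have := homit y hy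
    rw [h0, norm_zero] at this
    linarith
  have hφ : DifferentiableOn ℂ (fun y => (h y + 1)⁻¹) (ball c r) :=
    (hhd.add_const _).inv hne1
  have hφb : ∀ y ∈ ball c r, ‖(h y + 1)⁻¹‖ ≤ 5 / 2 := by
    intro y hy
    rw [norm_inv]
    calc ‖h y + 1‖⁻¹ ≤ (2 / 5 : ℝ)⁻¹ := inv_anti₀ (by norm_num) (homit y hy)
      _ = 5 / 2 := by norm_num
  have hφc : (h c + 1)⁻¹ = 1 / 2 := by rw [hc1]; norm_num
  -- The radius is 3 = 5/2 + 1/2. On the disc of radius r/12 the function 1/(h + 1) thus stays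
  -- within 1/4 of 1/2, so |h + 1| ≤ 4 and |h² - 1| ≤ 4 · 6 = 24.
  have hmaps : MapsTo (fun y => (h y + 1)⁻¹) (ball c r) (closedBall ((h c + 1)⁻¹) 3) := by
    intro y hy
    rw [mem_closedBall, dist_eq_norm, hφc]
    have h2 : ‖(1 / 2 : ℂ)‖ = 1 / 2 := by norm_num
    linarith [norm_sub_le ((h y + 1)⁻¹) (1 / 2), hφb y hy]
  have hS := Complex.dist_le_div_mul_dist_of_mapsTo_ball hφ hmaps hzr
  have hdz : dist z c < r / 12 := hz
  have hS' : dist ((h z + 1)⁻¹) (1 / 2) ≤ 1 / 4 := by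
    rw [← hφc]
    refine hS.trans ?_
    calc 3 / r * dist z c ≤ 3 / r * (r / 12) := by gcongr
      _ = 1 / 4 := by field_simp; norm_num
  have hlow : 1 / 4 ≤ ‖(h z + 1)⁻¹‖ := by
    rw [dist_eq_norm] at hS'
    have h2 : ‖(1 / 2 : ℂ)‖ = 1 / 2 := by norm_num
    have h3 : ‖(1 / 2 : ℂ)‖ ≤ ‖(h z + 1)⁻¹‖ + ‖(h z + 1)⁻¹ - 1 / 2‖ := by
      have := norm_sub_le ((h z + 1)⁻¹) ((h z + 1)⁻¹ - 1 / 2)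
      simpa using this
    linarith
  have hup : ‖h z + 1‖ ≤ 4 := by
    rw [norm_inv] at hlow
    have := inv_anti₀ (by norm_num) hlow
    simpa using this
  have hfin : f z - f c = -((h z + 1) * ((h z + 1) - 2)) * (w - f c) := by
    have e1 : (h z + 1) * ((h z + 1) - 2) = q (f z) - 1 := by rw [← hh z]; ring
    rw [e1]
    simp only [hq]
    field_simp
    ring
  rw [hfin, norm_mul, norm_neg, norm_mul, hwn]
  have e2 : ‖(h z + 1) - 2‖ ≤ 6 := by
    have := norm_sub_le (h z + 1) 2
    have h2 : ‖(2 : ℂ)‖ = 2 := by norm_num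
    linarith
  have : ‖h z + 1‖ * ‖(h z + 1) - 2‖ ≤ 24 := by
    nlinarith [norm_nonneg (h z + 1), norm_nonneg ((h z + 1) - 2)]
  exact mul_le_mul_of_nonneg_right this hρ.le

open Metric in
/-- Distortion bounds for injective holomorphic functions on a disc. -/
theorem koebe_distortion {f : ℂ → ℂ} {c : ℂ} {r : ℝ} (hr : 0 < r)
    (hd : DifferentiableOn ℂ f (ball c r)) (hinj : InjOn f (ball c r))
    (hne : ∀ z ∈ ball c r, deriv f z ≠ 0) (hb : Bornology.IsBounded (f '' ball c r)) :
    ball (f c) (r * ‖deriv f c‖ / 288) ⊆ f '' ball c r ∧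
      (∀ z ∈ ball c (r / 12), ‖f z - f c‖ ≤ 24 * r * ‖deriv f c‖) ∧
      ∀ z ∈ ball c (r / 24), ‖deriv f z‖ ≤ 1152 * ‖deriv f c‖ := by
  obtain ⟨ρ, hρ, h1, h2, h3⟩ := exists_ball_subset_image_and_norm_sub_le hr hd hinj hne hb
  have h4 : ∀ z ∈ ball c (r / 12), ‖f z - f c‖ ≤ 24 * r * ‖deriv f c‖ := by
    intro z hz
    have := h3 z hz
    nlinarith
  refine ⟨?_, h4, ?_⟩
  -- Schwarz on the disc of radius r/12 gives |f'(c)| ≤ 12 · 24 ρ / r, the converse comparison of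
  -- `ρ` with r|f'(c)|.
  · refine (ball_subset_ball ?_).trans h2
    have h5 : ‖deriv f c‖ ≤ 24 * ρ / (r / 12) := by
      refine Complex.norm_deriv_le_div_of_mapsTo_ball
        (hd.mono (ball_subset_ball (by linarith))) ?_ (by positivity)
      intro z hz
      rw [mem_closedBall, dist_eq_norm]
      exact h3 z hz
    rw [le_div_iff₀ (by positivity)] at h5
    linarith
  · intro z hz
    have hsub : ball z (r / 24) ⊆ ball c (r / 12) := by
      refine ball_subset_ball' ?_
      have : dist z c < r / 24 := hz
      linarith
    have h5 : ‖deriv f z‖ ≤ (2 * (24 * r * ‖deriv f c‖)) / (r / 24) := by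
      refine Complex.norm_deriv_le_div_of_mapsTo_ball
        (hd.mono (hsub.trans (ball_subset_ball (by linarith)))) ?_ (by positivity)
      intro y hy
      rw [mem_closedBall, dist_eq_norm]
      have e : f y - f z = (f y - f c) - (f z - f c) := by ring
      rw [e]
      have := norm_sub_le (f y - f c) (f z - f c)
      have hz' := h4 z (hsub (mem_ball_self (by positivity)))
      linarith [h4 y (hsub hy)]
    calc ‖deriv f z‖ ≤ _ := h5
      _ = 1152 * ‖deriv f c‖ := by field_simp; ring

/-! ### Plane model of the inverse map and its inverse branches -/

/-- Complex conjugation if `b` is true, the identity otherwise. -/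
def conjIf (b : Bool) (z : ℂ) : ℂ := if b then starRingEnd ℂ z else z

theorem conjIf_true : conjIf true = starRingEnd ℂ := rfl

theorem conjIf_false : conjIf false = id := rfl

theorem conjIf_involutive (b : Bool) : Function.Involutive (conjIf b) := by
  intro z
  cases b <;> simp [conjIf]

theorem isometry_conjIf (b : Bool) : Isometry (conjIf b) := by
  cases b
  · exact isometry_id
  · exact Complex.isometry_conj

theorem norm_conjIf (b : Bool) (z : ℂ) : ‖conjIf b z‖ = ‖z‖ := by
  cases b <;> simp [conjIf]

theorem hasDerivAt_conjIf_conj {b : Bool} {f : ℂ → ℂ} {d z : ℂ}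
    (h : HasDerivAt f d (conjIf b z)) :
    HasDerivAt (fun w => conjIf b (f (conjIf b w))) (conjIf b d) z := by
  cases b
  · exact h
  · have := HasDerivAt.conj_conj h
    simpa [conjIf, Function.comp_def] using this

/-- Data extracted from an invariantly inverse-like correspondence in a plane coordinate: the
inverse map `g : L → K` is holomorphic up to conjugation inside `L`, with finite fibres and finitely
many critical values, and is open over the interior of `K`. -/
structure PlanarSystem where
  anti : Bool
  K : Set ℂ
  L : Set ℂ
  g : ℂ → ℂ
  isCompact_K : IsCompact K
  isCompact_L : IsCompact L
  L_subset : L ⊆ K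
  mapsTo : MapsTo g L K
  continuousOn : ContinuousOn g L
  differentiableAt : ∀ v ∈ interior L, DifferentiableAt ℂ (fun w => conjIf anti (g w)) v
  mem_interior : ∀ v ∈ L, g v ∈ interior K → v ∈ interior L
  finite_fiber : ∀ u, (L ∩ g ⁻¹' {u}).Finite
  finite_crit : {y | ∃ v ∈ interior L, deriv (fun w => conjIf anti (g w)) v = 0 ∧ g v = y}.Finite

namespace PlanarSystem

variable (G : PlanarSystem)

/-- The conjugation that turns `g^k` into a holomorphic map. -/
def tw (k : ℕ) : ℂ → ℂ := (conjIf G.anti)^[k]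

/-- The points at which `g^k` is defined. -/
def dom (k : ℕ) : Set ℂ := {v | v ∈ G.K ∧ ∀ i < k, G.g^[i] v ∈ G.L}

/-- The fibres of `g^k`. -/
def fib (k : ℕ) (y : ℂ) : Set ℂ := {v | v ∈ G.dom k ∧ G.g^[k] v = y}

/-- The holomorphic representative of `g^k`. -/
def rep (k : ℕ) (v : ℂ) : ℂ := G.tw k (G.g^[k] v)

/-- The forward orbits of the critical values of `g`. -/
def orb : Set ℂ :=
  {y | ∃ i v, v ∈ G.dom (i + 1) ∧ v ∈ interior G.L ∧
    deriv (fun w => conjIf G.anti (G.g w)) v = 0 ∧ G.g^[i + 1] v = y}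

theorem tw_eq (k : ℕ) : ∃ b, G.tw k = conjIf b := by
  induction k with
  | zero => exact ⟨false, rfl⟩
  | succ k ih =>
    obtain ⟨b, hb⟩ := ih
    rw [tw, Function.iterate_succ', ← tw, hb]
    cases b
    · exact ⟨G.anti, rfl⟩
    · cases h : G.anti
      · exact ⟨true, rfl⟩
      · refine ⟨false, funext fun z => ?_⟩
        simp [conjIf]

theorem tw_tw (k : ℕ) (z : ℂ) : G.tw k (G.tw k z) = z := by
  obtain ⟨b, hb⟩ := G.tw_eq k
  rw [hb]; exact conjIf_involutive b z

theorem isometry_tw (k : ℕ) : Isometry (G.tw k) := by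
  obtain ⟨b, hb⟩ := G.tw_eq k
  rw [hb]; exact isometry_conjIf b

theorem norm_tw (k : ℕ) (z : ℂ) : ‖G.tw k z‖ = ‖z‖ := by
  obtain ⟨b, hb⟩ := G.tw_eq k
  rw [hb]; exact norm_conjIf b z

theorem norm_tw_sub (k : ℕ) (z w : ℂ) : ‖G.tw k z - G.tw k w‖ = ‖z - w‖ := by
  rw [← dist_eq_norm, (G.isometry_tw k).dist_eq, dist_eq_norm]

theorem hasDerivAt_tw_conj (k : ℕ) {f : ℂ → ℂ} {d z : ℂ} (h : HasDerivAt f d (G.tw k z)) :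
    HasDerivAt (fun w => G.tw k (f (G.tw k w))) (G.tw k d) z := by
  obtain ⟨b, hb⟩ := G.tw_eq k
  rw [hb] at h ⊢
  exact hasDerivAt_conjIf_conj h

variable {G}

theorem dom_succ (k : ℕ) : G.dom (k + 1) = G.dom k ∩ G.g^[k] ⁻¹' G.L := by
  ext v
  simp only [dom, mem_ofPred_eq, mem_inter_iff, mem_preimage]
  constructor
  · rintro ⟨h1, h2⟩
    exact ⟨⟨h1, fun i hi => h2 i (by omega)⟩, h2 k (by omega)⟩
  · rintro ⟨⟨h1, h2⟩, h3⟩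
    refine ⟨h1, fun i hi => ?_⟩
    rcases Nat.lt_succ_iff_lt_or_eq.1 hi with h | rfl
    exacts [h2 i h, h3]

theorem iterate_mem {k : ℕ} {v : ℂ} (hv : v ∈ G.dom k) : G.g^[k] v ∈ G.K := by
  cases k with
  | zero => exact hv.1
  | succ k =>
    rw [Function.iterate_succ_apply']
    exact G.mapsTo (hv.2 k (by omega))

theorem iterate_mem_dom {k : ℕ} {v : ℂ} (hv : v ∈ G.dom k) {i : ℕ} (hi : i ≤ k) :
    G.g^[i] v ∈ G.dom (k - i) := by
  refine ⟨iterate_mem ⟨hv.1, fun j hj => hv.2 j (by omega)⟩, fun j hj => ?_⟩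
  rw [← Function.iterate_add_apply]
  exact hv.2 _ (by omega)

theorem continuousOn_iterate (k : ℕ) : ContinuousOn G.g^[k] (G.dom k) := by
  induction k with
  | zero => exact continuousOn_id
  | succ k ih =>
    rw [Function.iterate_succ']
    refine G.continuousOn.comp (ih.mono ?_) ?_
    · rw [dom_succ]; exact inter_subset_left
    · intro v hv; exact hv.2 k (by omega)

theorem isCompact_dom (k : ℕ) : IsCompact (G.dom k) := by
  induction k with
  | zero =>
    have : G.dom 0 = G.K := by ext v; simp [dom]
    rw [this]; exact G.isCompact_K
  | succ k ih =>
    rw [dom_succ]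
    exact ih.of_isClosed_subset
      ((continuousOn_iterate k).preimage_isClosed_of_isClosed ih.isClosed G.isCompact_L.isClosed)
      inter_subset_left

theorem finite_fib (k : ℕ) (y : ℂ) : (G.fib k y).Finite := by
  induction k generalizing y with
  | zero =>
    refine (finite_singleton y).subset ?_
    rintro v ⟨-, h⟩
    exact h
  | succ k ih =>
    refine ((G.finite_fiber y).biUnion fun u _ => ih u).subset ?_
    rintro v ⟨hv, h⟩
    rw [dom_succ] at hv
    rw [Function.iterate_succ_apply'] at h
    exact mem_biUnion (⟨hv.2, h⟩ : G.g^[k] v ∈ G.L ∩ G.g ⁻¹' {y}) ⟨hv.1, rfl⟩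

/-- Interior membership travels backwards along the orbit by the field `mem_interior`, because the
interior of L lies in that of K. -/
theorem iterate_mem_interior {k : ℕ} {v : ℂ} (hv : v ∈ G.dom k) (h : G.g^[k] v ∈ interior G.K) :
    ∀ i < k, G.g^[i] v ∈ interior G.L := by
  induction k with
  | zero => intro i hi; omega
  | succ k ih =>
    rw [dom_succ] at hv
    rw [Function.iterate_succ_apply'] at h
    have h1 : G.g^[k] v ∈ interior G.L := G.mem_interior _ hv.2 h
    intro i hi
    rcases Nat.lt_succ_iff_lt_or_eq.1 hi with h' | rfl
    · exact ih hv.1 (interior_mono G.L_subset h1) i h'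
    · exact h1

theorem dom_mem_nhds {k : ℕ} {v : ℂ} (hv : v ∈ G.dom k) (h : G.g^[k] v ∈ interior G.K) :
    G.dom k ∈ 𝓝 v := by
  induction k with
  | zero =>
    have : G.dom 0 = G.K := by ext v; simp [dom]
    rw [this]; exact mem_interior_iff_mem_nhds.1 h
  | succ k ih =>
    have hi := iterate_mem_interior hv h k (by omega)
    rw [dom_succ] at hv ⊢
    have h1 := ih hv.1 (interior_mono G.L_subset hi)
    refine inter_mem h1 ?_
    exact ((continuousOn_iterate k).continuousAt h1).preimage_mem_nhds
      (mem_interior_iff_mem_nhds.1 hi)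

/-- Chain rule: `rep (k + 1)` is `rep k` followed by the holomorphic representative of g conjugated
on both sides by `tw k`, and such a conjugate is again holomorphic. -/
theorem exists_hasDerivAt_rep {k : ℕ} {v : ℂ}
    (h : ∀ i < k, G.g^[i] v ∈ interior G.L) :
    ∃ d, HasDerivAt (G.rep k) d v ∧
      ((∀ i < k, deriv (fun w => conjIf G.anti (G.g w)) (G.g^[i] v) ≠ 0) → d ≠ 0) := by
  induction k with
  | zero => exact ⟨1, hasDerivAt_id v, fun _ => one_ne_zero⟩
  | succ k ih =>
    obtain ⟨d, hd, hd0⟩ := ih fun i hi => h i (by omega)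
    have h1 := (G.differentiableAt _ (h k (by omega))).hasDerivAt
    set d' := deriv (fun w => conjIf G.anti (G.g w)) (G.g^[k] v) with hd'
    have h2 : HasDerivAt (fun w => conjIf G.anti (G.g w)) d' (G.tw k (G.rep k v)) := by
      rw [rep, tw_tw]; exact h1
    have h3 := (G.hasDerivAt_tw_conj k h2).comp v hd
    have h4 : G.rep (k + 1) =
        (fun w => G.tw k ((fun w => conjIf G.anti (G.g w)) (G.tw k w))) ∘ G.rep k := by
      funext w
      simp only [rep, Function.comp, tw_tw]
      rw [Function.iterate_succ_apply', tw, Function.iterate_succ_apply]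
      rfl
    rw [h4]
    refine ⟨_, h3, fun hne => mul_ne_zero ?_ (hd0 fun i hi => hne i (by omega))⟩
    rw [← norm_ne_zero_iff, norm_tw, norm_ne_zero_iff]
    exact hne k (by omega)

theorem differentiableAt_rep {k : ℕ} {v : ℂ} (hv : v ∈ G.dom k) (h : G.g^[k] v ∈ interior G.K) :
    DifferentiableAt ℂ (G.rep k) v :=
  (exists_hasDerivAt_rep (iterate_mem_interior hv h)).choose_spec.1.differentiableAt

theorem deriv_rep_ne_zero {k : ℕ} {v : ℂ} (hv : v ∈ G.dom k) (h : G.g^[k] v ∈ interior G.K)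
    (ho : G.g^[k] v ∉ G.orb) : deriv (G.rep k) v ≠ 0 := by
  have hi := iterate_mem_interior hv h
  obtain ⟨d, hd, hd0⟩ := exists_hasDerivAt_rep hi
  rw [hd.deriv]
  refine hd0 fun i hik h0 => ho ⟨k - i - 1, G.g^[i] v, ?_, hi i hik, h0, ?_⟩
  · have := iterate_mem_dom hv hik.le
    rwa [show k - i - 1 + 1 = k - i by omega]
  · rw [← Function.iterate_add_apply]
    congr 2
    omega

/-- The reciprocal of the absolute value of the derivative of `g^k`. -/
def wt (G : PlanarSystem) (k : ℕ) (v : ℂ) : ℝ := ‖deriv (G.rep k) v‖⁻¹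

/-- A branch of the inverse of `g^k` on `B`. -/
def IsSection (G : PlanarSystem) (k : ℕ) (B : Set ℂ) (f : ℂ → ℂ) : Prop :=
  ContinuousOn f B ∧ ∀ y ∈ B, f y ∈ G.fib k y

theorem exists_openPartialHomeomorph {k : ℕ} {v : ℂ} (hv : v ∈ G.dom k)
    (h : G.g^[k] v ∈ interior G.K) (ho : G.g^[k] v ∉ G.orb) :
    ∃ φ : OpenPartialHomeomorph ℂ ℂ, v ∈ φ.source ∧ φ.source ⊆ G.dom k ∧ φ = G.g^[k] := by
  have h1 : ∀ᶠ w in 𝓝 v, DifferentiableAt ℂ (G.rep k) w := by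
    have hn := dom_mem_nhds hv h
    have hc := (continuousOn_iterate k).continuousAt hn
    filter_upwards [eventually_mem_nhds_iff.2 hn, hc.eventually (isOpen_interior.mem_nhds h)]
      with w hw hw'
    exact differentiableAt_rep (mem_of_mem_nhds hw) hw'
  have h2 : HasStrictDerivAt (G.rep k) (deriv (G.rep k) v) v :=
    (Complex.analyticAt_iff_eventually_differentiableAt.2 h1).hasStrictDerivAt
  let φ := (h2.hasStrictFDerivAt_equiv (deriv_rep_ne_zero hv h ho)).toOpenPartialHomeomorph (G.rep k)
  have hφ : ⇑φ = G.rep k := HasStrictFDerivAt.toOpenPartialHomeomorph_coe _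
  have hvφ : v ∈ φ.source := HasStrictFDerivAt.mem_toOpenPartialHomeomorph_source _
  let e : ℂ ≃ₜ ℂ :=
    { toFun := G.tw k, invFun := G.tw k, left_inv := G.tw_tw k, right_inv := G.tw_tw k
      continuous_toFun := (G.isometry_tw k).continuous
      continuous_invFun := (G.isometry_tw k).continuous }
  let φ' := (φ.trans e.toOpenPartialHomeomorph).restr (interior (G.dom k))
  refine ⟨φ', ?_, ?_, ?_⟩
  · simp [φ', hvφ, mem_interior_iff_mem_nhds.2 (dom_mem_nhds hv h)]
  · intro w hw
    simp [φ'] at hw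
    exact interior_subset hw.2
  · funext w
    simp [φ', hφ, rep, e, tw_tw]

/-- The domain of g^k is compact, and over `U` the map is a local homeomorphism since no critical
point lies on the orbits involved; these two facts give a covering. -/
theorem isCoveringMapOn (k : ℕ) {U : Set ℂ} (hU : U ⊆ interior G.K \ G.orb) :
    IsCoveringMapOn (fun v : G.dom k => G.g^[k] v) U := by
  have : CompactSpace (G.dom k) := isCompact_iff_compactSpace.1 (isCompact_dom k)
  refine IsCoveringMapOn.of_isLocalHomeomorphOn (continuousOn_iff_continuous_domRestrict.1
    (continuousOn_iterate k)) ?_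
  refine IsLocalHomeomorphOn.mk _ _ ?_
  rintro ⟨v, hv⟩ hvU
  obtain ⟨φ, h1, h2, h3⟩ := exists_openPartialHomeomorph hv (hU hvU).1 (hU hvU).2
  have hmem : ∀ y ∈ φ.target, φ.symm y ∈ G.dom k := fun y hy => h2 (φ.map_target hy)
  classical
  refine ⟨{ toFun := fun v => φ v
            invFun := fun y => if hy : φ.symm y ∈ G.dom k then ⟨φ.symm y, hy⟩ else ⟨v, hv⟩
            source := Subtype.val ⁻¹' φ.source
            target := φ.target
            map_source' := fun x hx => φ.map_source hx
            map_target' := ?_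
            left_inv' := ?_
            right_inv' := ?_
            open_source := φ.open_source.preimage continuous_subtype_val
            open_target := φ.open_target
            continuousOn_toFun := φ.continuousOn.comp continuous_subtype_val.continuousOn
              fun x hx => hx
            continuousOn_invFun := ?_ }, h1, ?_⟩
  · intro y hy
    simp [hmem y hy, hy]
  · rintro ⟨x, hx⟩ hxs
    simp [φ.left_inv hxs, hx]
  · intro y hy
    simp [hmem y hy, φ.right_inv hy]
  · rw [Topology.IsInducing.subtypeVal.continuousOn_iff]
    refine φ.continuousOn_symm.congr fun y hy => ?_
    simp [hmem y hy]
  · intro x hx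
    simp [h3]

open Metric in
-- A disc is simply connected, so its inclusion lifts uniquely through the covering once one value
-- is prescribed.
theorem exists_section {k : ℕ} {c : ℂ} {r : ℝ} (hB : ball c r ⊆ interior G.K \ G.orb)
    {y v : ℂ} (hy : y ∈ ball c r) (hv : v ∈ G.fib k y) :
    ∃ f, G.IsSection k (ball c r) f ∧ f y = v ∧
      ∀ f', G.IsSection k (ball c r) f' → f' y = v → EqOn f' f (ball c r) := by
  have hr : 0 < r := nonempty_ball.1 ⟨y, hy⟩
  have := contractibleSpace_ball (x := c) hr
  have : LocallyPathConnectedSpace (ball c r) := isOpen_ball.locallyPathConnectedSpace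
  obtain ⟨F, ⟨hF1, hF2⟩, hF3⟩ :=
    (isCoveringMapOn k hB).existsUnique_continuousMap_lifts
      (⟨Subtype.val, continuous_subtype_val⟩ : C(ball c r, ℂ)) (a₀ := ⟨y, hy⟩)
      (e₀ := ⟨v, hv.1⟩) hv.2 (fun a => a.2)
  classical
  refine ⟨fun w => if hw : w ∈ ball c r then F ⟨w, hw⟩ else 0, ⟨?_, ?_⟩, ?_, ?_⟩
  · rw [continuousOn_iff_continuous_domRestrict]
    refine (continuous_subtype_val.comp F.continuous).congr fun w => ?_
    have := w.2
    simp only [Set.domRestrict_apply, Function.comp]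
    rw [dif_pos w.2]
  · intro w hw
    simp only [dif_pos hw]
    exact ⟨(F ⟨w, hw⟩).2, congrFun hF2 ⟨w, hw⟩⟩
  · simp only [dif_pos hy]
    rw [hF1]
  · intro f' hf' hf'y
    have h := hF3 ⟨fun a => ⟨f' a, (hf'.2 a a.2).1⟩, Continuous.subtype_mk
      (continuousOn_iff_continuous_domRestrict.1 hf'.1) _⟩
      ⟨Subtype.ext hf'y, funext fun a => (hf'.2 a a.2).2⟩
    intro w hw
    simp only [dif_pos hw]
    rw [← h]
    rfl

open Metric in
theorem IsSection.eqOn {k : ℕ} {c : ℂ} {r : ℝ} (hB : ball c r ⊆ interior G.K \ G.orb)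
    {f₁ f₂ : ℂ → ℂ} (h₁ : G.IsSection k (ball c r) f₁) (h₂ : G.IsSection k (ball c r) f₂)
    {y : ℂ} (hy : y ∈ ball c r) (h : f₁ y = f₂ y) : EqOn f₁ f₂ (ball c r) := by
  obtain ⟨f, -, -, hf⟩ := exists_section hB hy (h₂.2 y hy)
  exact (hf f₁ h₁ h).trans (hf f₂ h₂ rfl).symm

theorem IsSection.hasDerivAt {k : ℕ} {U : Set ℂ} (hU : IsOpen U) (hB : U ⊆ interior G.K \ G.orb)
    {f : ℂ → ℂ} (h : G.IsSection k U f) {y : ℂ} (hy : y ∈ U) :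
    HasDerivAt (fun w => G.tw k (f w)) (G.tw k (deriv (G.rep k) (f y))⁻¹) y := by
  have hfy := h.2 y hy
  have hyK := hB hy
  rw [← hfy.2] at hyK
  have hd := differentiableAt_rep hfy.1 hyK.1
  have hne := deriv_rep_ne_zero hfy.1 hyK.1 hyK.2
  have htw := (G.isometry_tw k).continuous
  have h1 : HasDerivAt (fun w => f (G.tw k w)) (deriv (G.rep k) (f y))⁻¹ (G.tw k y) := by
    refine HasDerivAt.of_local_left_inverse (f := G.rep k) ?_ ?_ hne ?_
    · refine ContinuousAt.comp ?_ htw.continuousAt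
      rw [tw_tw]
      exact h.1.continuousAt (hU.mem_nhds hy)
    · rw [tw_tw]; exact hd.hasDerivAt
    · have : ∀ᶠ w in 𝓝 (G.tw k y), G.tw k w ∈ U := by
        refine htw.continuousAt.eventually_mem ?_
        rw [tw_tw]
        exact hU.mem_nhds hy
      filter_upwards [this] with w hw
      rw [rep, (h.2 _ hw).2, tw_tw]
  have h2 := G.hasDerivAt_tw_conj k h1
  simpa only [tw_tw] using h2

theorem IsSection.norm_deriv {k : ℕ} {U : Set ℂ} (hU : IsOpen U) (hB : U ⊆ interior G.K \ G.orb)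
    {f : ℂ → ℂ} (h : G.IsSection k U f) {y : ℂ} (hy : y ∈ U) :
    ‖deriv (fun w => G.tw k (f w)) y‖ = G.wt k (f y) := by
  rw [(h.hasDerivAt hU hB hy).deriv, norm_tw, norm_inv, wt]

end PlanarSystem

/-! ### Distortion of inverse branches and derivative sums -/

namespace PlanarSystem

variable {G : PlanarSystem}

open Metric in
theorem IsSection.distortion {k : ℕ} {c : ℂ} {r : ℝ} (hr : 0 < r)
    (hB : ball c r ⊆ interior G.K \ G.orb) {f : ℂ → ℂ} (hf : G.IsSection k (ball c r) f) :
    ball (f c) (r * G.wt k (f c) / 288) ⊆ f '' ball c r ∧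
      (∀ z ∈ ball c (r / 12), ‖f z - f c‖ ≤ 24 * r * G.wt k (f c)) ∧
      ∀ z ∈ ball c (r / 24), G.wt k (f z) ≤ 1152 * G.wt k (f c) := by
  have hc : c ∈ ball c r := mem_ball_self hr
  have hd : DifferentiableOn ℂ (fun w => G.tw k (f w)) (ball c r) := fun y hy =>
    (hf.hasDerivAt isOpen_ball hB hy).differentiableAt.differentiableWithinAt
  have hne : ∀ z ∈ ball c r, deriv (fun w => G.tw k (f w)) z ≠ 0 := by
    intro z hz
    have hz' := hB hz
    rw [← (hf.2 z hz).2] at hz'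
    rw [← norm_ne_zero_iff, hf.norm_deriv isOpen_ball hB hz, wt]
    exact inv_ne_zero (norm_ne_zero_iff.2 (deriv_rep_ne_zero (hf.2 z hz).1 hz'.1 hz'.2))
  have hinj : InjOn (fun w => G.tw k (f w)) (ball c r) := by
    intro y hy y' hy' h
    have h' : f y = f y' := (G.isometry_tw k).injective h
    rw [← (hf.2 y hy).2, h', (hf.2 y' hy').2]
  have hb : Bornology.IsBounded ((fun w => G.tw k (f w)) '' ball c r) := by
    refine ((G.isCompact_K.image (G.isometry_tw k).continuous).isBounded).subset ?_
    rintro _ ⟨y, hy, rfl⟩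
    exact mem_image_of_mem _ (hf.2 y hy).1.1
  obtain ⟨h1, h2, h3⟩ := koebe_distortion hr hd hinj hne hb
  rw [hf.norm_deriv isOpen_ball hB hc] at h1 h2 h3
  refine ⟨?_, ?_, ?_⟩
  · intro w hw
    have : G.tw k w ∈ ball (G.tw k (f c)) (r * G.wt k (f c) / 288) := by
      rw [mem_ball, (G.isometry_tw k).dist_eq]; exact hw
    obtain ⟨y, hy, hyw⟩ := h1 this
    exact ⟨y, hy, (G.isometry_tw k).injective hyw⟩
  · intro z hz
    rw [← G.norm_tw_sub k]
    exact h2 z hz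
  · intro z hz
    rw [← hf.norm_deriv isOpen_ball hB (ball_subset_ball (by linarith) hz)]
    exact h3 z hz

/-- The sum of the absolute values of the derivatives of the branches of the inverse of `g^k`. -/
def wtSum (G : PlanarSystem) (k : ℕ) (y : ℂ) : ℝ := ∑ v ∈ (G.finite_fib k y).toFinset, G.wt k v

theorem wt_nonneg (k : ℕ) (v : ℂ) : 0 ≤ G.wt k v := inv_nonneg.2 (norm_nonneg _)

theorem wtSum_nonneg (k : ℕ) (y : ℂ) : 0 ≤ G.wtSum k y :=
  Finset.sum_nonneg fun _ _ => wt_nonneg k _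

open Metric in
-- Inverse branches on the disc transport the fibre over `y` injectively into the fibre over `c`,
-- each changing its weight by a factor of at most 1152.
theorem wtSum_le {c : ℂ} {r : ℝ} (hr : 0 < r) (hB : ball c r ⊆ interior G.K \ G.orb) {y : ℂ}
    (hy : y ∈ ball c (r / 24)) (k : ℕ) : G.wtSum k y ≤ 1152 * G.wtSum k c := by
  have hy' : y ∈ ball c r := ball_subset_ball (by linarith) hy
  have hc : c ∈ ball c r := mem_ball_self hr
  choose! f hf hfy _ using fun v (hv : v ∈ G.fib k y) => exists_section hB hy' hv
  have hle : ∀ v ∈ (G.finite_fib k y).toFinset, G.wt k v ≤ 1152 * G.wt k (f v c) := by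
    intro v hv
    rw [Set.Finite.mem_toFinset] at hv
    have := ((hf v hv).distortion hr hB).2.2 y hy
    rwa [hfy v hv] at this
  have hinj : Set.InjOn (fun v => f v c) (G.finite_fib k y).toFinset := by
    intro v hv v' hv' h
    rw [Finset.mem_coe, Set.Finite.mem_toFinset] at hv hv'
    have := (hf v hv).eqOn hB (hf v' hv') hc h hy'
    rwa [hfy v hv, hfy v' hv'] at this
  calc G.wtSum k y ≤ ∑ v ∈ (G.finite_fib k y).toFinset, 1152 * G.wt k (f v c) :=
        Finset.sum_le_sum hle
    _ = 1152 * ∑ v ∈ (G.finite_fib k y).toFinset, G.wt k (f v c) := by rw [Finset.mul_sum]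
    _ = 1152 * ∑ u ∈ (G.finite_fib k y).toFinset.image (fun v => f v c), G.wt k u := by
        rw [Finset.sum_image hinj]
    _ ≤ 1152 * G.wtSum k c := by
        gcongr
        refine Finset.sum_le_sum_of_subset_of_nonneg ?_ fun v _ _ => wt_nonneg k v
        intro u hu
        obtain ⟨v, hv, rfl⟩ := Finset.mem_image.1 hu
        rw [Set.Finite.mem_toFinset] at hv ⊢
        exact (hf v hv).2 c hc

/-- The derivative sums at the two points are comparable, uniformly in the iterate. -/
def Comparable (G : PlanarSystem) (a b : ℂ) : Prop :=
  ∃ C > 0, ∀ k, G.wtSum k a ≤ C * G.wtSum k b ∧ G.wtSum k b ≤ C * G.wtSum k a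

theorem Comparable.symm {a b : ℂ} (h : G.Comparable a b) : G.Comparable b a := by
  obtain ⟨C, hC, h⟩ := h
  exact ⟨C, hC, fun k => (h k).symm⟩

theorem Comparable.trans {a b c : ℂ} (h : G.Comparable a b) (h' : G.Comparable b c) :
    G.Comparable a c := by
  obtain ⟨C, hC, h⟩ := h
  obtain ⟨C', hC', h'⟩ := h'
  refine ⟨C * C', by positivity, fun k => ⟨?_, ?_⟩⟩
  · calc G.wtSum k a ≤ C * G.wtSum k b := (h k).1
      _ ≤ C * (C' * G.wtSum k c) := by gcongr; exact (h' k).1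
      _ = _ := by ring
  · calc G.wtSum k c ≤ C' * G.wtSum k b := (h' k).2
      _ ≤ C' * (C * G.wtSum k a) := by gcongr; exact (h k).2
      _ = _ := by ring

open Metric in
theorem eventually_comparable {c : ℂ} (hc : c ∈ interior G.K) (hc' : c ∉ closure G.orb) :
    ∀ᶠ y in 𝓝 c, G.Comparable c y := by
  have hopen : IsOpen (interior G.K \ closure G.orb) := isOpen_interior.sdiff isClosed_closure
  obtain ⟨r, hr, hB⟩ := Metric.isOpen_iff.1 hopen c ⟨hc, hc'⟩
  have hB' : ball c r ⊆ interior G.K \ G.orb :=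
    hB.trans (sdiff_subset_sdiff_right subset_closure)
  filter_upwards [ball_mem_nhds c (show 0 < r / 48 by positivity)] with y hy
  refine ⟨1152, by norm_num, fun k => ⟨?_, ?_⟩⟩
  -- For the reverse inequality the disc is recentred at `y`: radius r/2 still fits, and `c` lies
  -- within (r/2)/24 = r/48 of `y`.
  · refine wtSum_le (r := r / 2) (by positivity) ((ball_subset_ball' ?_).trans hB') ?_ k
    · have : dist y c < r / 48 := hy
      linarith
    · rw [mem_ball, dist_comm]
      have : dist y c < r / 48 := hy
      linarith
  · exact wtSum_le hr hB' (ball_subset_ball (by linarith) hy) k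

/-! ### Iteration and postcritical points in a basin component -/

/-- `V` is a connected neighbourhood of the fixed point `p` of `g^N` in its basin of attraction. -/
structure IsBasin (G : PlanarSystem) (N : ℕ) (p : ℂ) (V : Set ℂ) : Prop where
  pos : 0 < N
  isOpen : IsOpen V
  isPreconnected : IsPreconnected V
  mem : p ∈ V
  subset : ∀ k, V ⊆ G.dom k
  fixed : G.g^[N] p = p
  tendsto : ∀ v ∈ V, Tendsto (fun k => (G.g^[N])^[k] v) atTop (𝓝 p)

variable {N : ℕ} {p : ℂ} {V : Set ℂ}

namespace IsBasin

theorem tendsto' (h : G.IsBasin N p V) {v : ℂ} (hv : v ∈ V) (m : ℕ) :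
    Tendsto (fun k => G.g^[m + N * k] v) atTop (𝓝 (G.g^[m] p)) := by
  have hc : ContinuousAt G.g^[m] p :=
    (continuousOn_iterate m).continuousAt (mem_of_superset (h.isOpen.mem_nhds h.mem) (h.subset m))
  have := hc.tendsto.comp (h.tendsto v hv)
  refine this.congr fun k => ?_
  rw [Function.iterate_add_apply, Function.iterate_mul]
  rfl

theorem subset_interior (h : G.IsBasin N p V) : V ⊆ interior G.L :=
  interior_maximal (fun _ hv => (h.subset 1 hv).2 0 one_pos) h.isOpen

/-- Orbits starting in `V` may leave `V`. Finite fibres make `rep k` nonconstant near each point of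
`V`, so it is open there, and g^k(V) is contained in L. -/
theorem iterate_mem_interior (h : G.IsBasin N p V) (k : ℕ) {v : ℂ} (hv : v ∈ V) :
    G.g^[k] v ∈ interior G.L := by
  induction k using Nat.strong_induction_on generalizing v with
  | _ k ih =>
    have hd : ∀ w ∈ V, DifferentiableAt ℂ (G.rep k) w := fun w hw =>
      (exists_hasDerivAt_rep fun i hi => ih i hi hw).choose_spec.1.differentiableAt
    have hV := h.isOpen.mem_nhds hv
    have ha : AnalyticAt ℂ (G.rep k) v := by
      rw [Complex.analyticAt_iff_eventually_differentiableAt]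
      filter_upwards [hV] with w hw using hd w hw
    have hmap : 𝓝 (G.rep k v) ≤ map (G.rep k) (𝓝 v) := by
      refine ha.eventually_constant_or_nhds_le_map_nhds.resolve_left fun hconst => ?_
      refine infinite_of_mem_nhds v (inter_mem hconst hV) ?_
      refine (finite_fib (G := G) k (G.g^[k] v)).subset ?_
      rintro w ⟨hw1, hw2⟩
      exact ⟨h.subset k hw2, (G.isometry_tw k).injective hw1⟩
    have h1 : G.rep k '' V ∈ 𝓝 (G.rep k v) := hmap (image_mem_map hV)
    have h2 : G.tw k ⁻¹' (G.rep k '' V) ∈ 𝓝 (G.g^[k] v) :=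
      (G.isometry_tw k).continuous.continuousAt.preimage_mem_nhds h1
    rw [mem_interior_iff_mem_nhds]
    filter_upwards [h2] with w hw
    obtain ⟨u, hu, huw⟩ := hw
    rw [← (G.isometry_tw k).injective huw]
    exact (h.subset (k + 1) hu).2 k (by omega)

theorem mem_interior (h : G.IsBasin N p V) {v : ℂ} (hv : v ∈ V) : v ∈ interior G.K :=
  interior_mono G.L_subset (h.subset_interior hv)

open Metric in
-- Equicontinuity of all iterates: Schwarz applies because they take values in the bounded set K.
theorem dist_iterate_le (h : G.IsBasin N p V) {y : ℂ} {R : ℝ} (hR : ball y R ⊆ V) {M : ℝ}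
    (hM : ∀ a ∈ G.K, ∀ b ∈ G.K, dist a b ≤ M) (k : ℕ) {v : ℂ} (hv : v ∈ ball y R) :
    dist (G.g^[k] v) (G.g^[k] y) ≤ M / R * dist v y := by
  have hy : y ∈ ball y R := mem_ball_self (nonempty_ball.1 ⟨v, hv⟩)
  have := Complex.dist_le_div_mul_dist_of_mapsTo_ball (f := G.rep k) (c := y) (R₁ := R) (R₂ := M)
    (fun w hw => (exists_hasDerivAt_rep fun i _ =>
      h.iterate_mem_interior i (hR hw)).choose_spec.1.differentiableAt.differentiableWithinAt)
    (fun w hw => by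
      rw [mem_closedBall, rep, rep, (G.isometry_tw k).dist_eq]
      exact hM _ (iterate_mem (h.subset k (hR hw))) _ (iterate_mem (h.subset k (hR hy)))) hv
  rwa [rep, rep, (G.isometry_tw k).dist_eq] at this

/-- A countable closed set containing the strict forward orbit of `u`. -/
theorem exists_isClosed_orbit (h : G.IsBasin N p V) {u : ℂ} (hu : u ∈ V) :
    ∃ A : Set ℂ, IsClosed A ∧ A.Countable ∧ (∀ i, G.g^[i + 1] u ∈ A) ∧
      ∀ a ∈ A, (∃ m, a = G.g^[m] p) ∨ ∃ i, a = G.g^[i + 1] u := by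
  refine ⟨⋃ m ∈ Finset.range N, insert (G.g^[m + 1] p) (range fun k => G.g^[m + 1 + N * k] u),
    ?_, ?_, ?_, ?_⟩
  · refine isClosed_biUnion_finset fun m _ => ?_
    exact (h.tendsto' hu (m + 1)).isCompact_insert_range.isClosed
  · exact (Finset.range N).countable_toSet.biUnion fun m _ => (countable_range _).insert _
  · intro i
    refine mem_biUnion (Finset.mem_coe.2 (Finset.mem_range.2 (Nat.mod_lt i h.pos)))
      (mem_insert_of_mem _ ⟨i / N, ?_⟩)
    have := Nat.mod_add_div i N
    simp only
    rw [show i % N + 1 + N * (i / N) = i + 1 by omega]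
  · intro a ha
    simp only [mem_iUnion] at ha
    obtain ⟨m, -, rfl | ⟨k, rfl⟩⟩ := ha
    · exact Or.inl ⟨_, rfl⟩
    · exact Or.inr ⟨m + N * k, by simp only; rw [show m + 1 + N * k = m + N * k + 1 by omega]⟩

/-- There are finitely many critical values, and an orbit that enters `V` accumulates only on the
attracting cycle. -/
theorem countable_post (h : G.IsBasin N p V) : (closure G.orb ∩ V).Countable := by
  set CV := {y | ∃ v ∈ interior G.L, deriv (fun w => conjIf G.anti (G.g w)) v = 0 ∧ G.g v = y}
    with hCV
  have hfin : CV.Finite := G.finite_crit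
  have h1 : G.orb ⊆ ⋃ c ∈ CV, {y | ∃ i, c ∈ G.dom i ∧ G.g^[i] c = y} := by
    rintro y ⟨i, v, hv, hvi, hv0, rfl⟩
    refine mem_biUnion (⟨v, hvi, hv0, rfl⟩ : G.g v ∈ CV) ⟨i, ?_, ?_⟩
    · exact iterate_mem_dom hv (i := 1) (by omega)
    · rw [Function.iterate_succ_apply]
  have h2 : closure G.orb ⊆ ⋃ c ∈ CV, closure {y | ∃ i, c ∈ G.dom i ∧ G.g^[i] c = y} := by
    rw [← hfin.closure_biUnion]
    exact closure_mono h1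
  refine Countable.mono (inter_subset_inter_left V h2) ?_
  rw [iUnion₂_inter]
  refine hfin.countable.biUnion fun c _ => ?_
  -- An orbit that reaches `V` is a finite piece followed by a convergent tail; one that never does
  -- has closure disjoint from the open set `V`.
  by_cases hc : ∃ i, c ∈ G.dom i ∧ G.g^[i] c ∈ V
  · obtain ⟨i₀, -, hi₀⟩ := hc
    obtain ⟨A, hA, hAc, hAi, -⟩ := h.exists_isClosed_orbit hi₀
    have hF : ((fun i => G.g^[i] c) '' Iic i₀).Finite := (finite_Iic i₀).image _
    refine Countable.mono (inter_subset_left.trans (closure_minimal ?_ (hF.isClosed.union hA)))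
      (hF.countable.union hAc)
    rintro y ⟨i, -, rfl⟩
    rcases le_or_gt i i₀ with hi | hi
    · exact Or.inl ⟨i, hi, rfl⟩
    · right
      have := hAi (i - i₀ - 1)
      rwa [← Function.iterate_add_apply, show i - i₀ - 1 + 1 + i₀ = i by omega] at this
  · have hemp : closure {y | ∃ i, c ∈ G.dom i ∧ G.g^[i] c = y} ∩ V = ∅ := by
      rw [← disjoint_iff_inter_eq_empty]
      refine Disjoint.closure_left ?_ h.isOpen
      rw [Set.disjoint_left]
      rintro y ⟨i, hi, rfl⟩ hy
      exact hc ⟨i, hi, hy⟩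
    rw [hemp]
    exact countable_empty

end IsBasin

end PlanarSystem

open Metric in
-- A disc is homeomorphic to the plane, where the complement of a countable set is connected.
theorem isPreconnected_ball_diff_countable (c : ℂ) {r : ℝ} (hr : 0 < r) {P : Set ℂ}
    (hP : (ball c r ∩ P).Countable) : IsPreconnected (ball c r \ P) := by
  let e := OpenPartialHomeomorph.univBall c r
  have hs : e.source = univ := OpenPartialHomeomorph.univBall_source c r
  have ht : e.target = ball c r := OpenPartialHomeomorph.univBall_target c hr
  have hinj : Function.Injective e := by
    rw [← injOn_univ, ← hs]; exact e.injOn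
  have hQ : (e ⁻¹' (ball c r ∩ P)).Countable := hP.preimage hinj
  have hcon := (hQ.isConnected_compl_of_one_lt_rank (by simp [Complex.rank_real_complex]))
  have heq : ball c r \ P = e '' (e ⁻¹' (ball c r ∩ P))ᶜ := by
    ext y
    constructor
    · rintro ⟨hy, hyP⟩
      rw [← ht] at hy
      refine ⟨e.symm y, ?_, e.right_inv hy⟩
      simp [e.right_inv hy, hyP]
    · rintro ⟨w, hw, rfl⟩
      have : e w ∈ ball c r := by rw [← ht]; exact e.map_source (by rw [hs]; trivial)
      refine ⟨this, fun hP' => hw ⟨this, hP'⟩⟩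
  rw [heq]
  refine hcon.isPreconnected.image _ (e.continuousOn.mono ?_)
  rw [hs]; exact subset_univ _

namespace PlanarSystem.IsBasin

variable {G : PlanarSystem} {N : ℕ} {p : ℂ} {V : Set ℂ}

open Metric in
-- Comparability is local off the postcritical set; it spreads over punctured discs, then over `V`
-- by connectedness.
theorem comparable (h : G.IsBasin N p V) {a b : ℂ} (ha : a ∈ V \ closure G.orb)
    (hb : b ∈ V \ closure G.orb) : G.Comparable a b := by
  have hcount := h.countable_post
  have hball : ∀ c r, ball c r ⊆ V → ∀ a ∈ ball c r \ closure G.orb,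
      ∀ b ∈ ball c r \ closure G.orb, G.Comparable a b := by
    intro c r hcr a ha b hb
    have hr : 0 < r := nonempty_ball.1 ⟨a, ha.1⟩
    have hpre := isPreconnected_ball_diff_countable c hr (P := closure G.orb)
      (Countable.mono (fun y hy => ⟨hy.2, hcr hy.1⟩ :
        ball c r ∩ closure G.orb ⊆ closure G.orb ∩ V) hcount)
    refine hpre.induction₂ G.Comparable (fun y hy => ?_) (fun _ _ _ _ _ _ h₁ h₂ => h₁.trans h₂)
      (fun _ _ _ _ h₁ => h₁.symm) ha hb
    exact mem_nhdsWithin_of_mem_nhds (eventually_comparable (h.mem_interior (hcr hy.1)) hy.2)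
  -- The relation is phrased with neighbourhoods so that it makes sense at postcritical points too.
  -- Transitivity uses a nonpostcritical point in the overlap, available because the exceptional set
  -- is countable.
  have key := h.isPreconnected.induction₂
    (fun v w => ∃ A ∈ 𝓝 v, ∃ B ∈ 𝓝 w, ∀ a ∈ A \ closure G.orb, ∀ b ∈ B \ closure G.orb,
      G.Comparable a b) (fun v hv => ?_) ?_ ?_ ha.1 hb.1
  · obtain ⟨A, hA, B, hB, hAB⟩ := key
    exact hAB a ⟨mem_of_mem_nhds hA, ha.2⟩ b ⟨mem_of_mem_nhds hB, hb.2⟩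
  · obtain ⟨r, hr, hrV⟩ := Metric.isOpen_iff.1 h.isOpen v hv
    filter_upwards [mem_nhdsWithin_of_mem_nhds (ball_mem_nhds v hr)] with w hw
    exact ⟨ball v r, ball_mem_nhds v hr, ball v r, isOpen_ball.mem_nhds hw, hball v r hrV⟩
  · rintro u v w - hv - ⟨A, hA, B, hB, hAB⟩ ⟨A', hA', B', hB', hAB'⟩
    refine ⟨A, hA, B', hB', fun a ha b hb => ?_⟩
    have hn : B ∩ A' ∩ V ∈ 𝓝 v := inter_mem (inter_mem hB hA') (h.isOpen.mem_nhds hv)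
    obtain ⟨y, hy', hy⟩ := (hcount.dense_compl ℝ).inter_nhds_nonempty hn
    have hyn : y ∉ closure G.orb := fun hh => hy' ⟨hh, hy.2⟩
    exact (hAB a ha y ⟨hy.1.1, hyn⟩).trans (hAB' y ⟨hy.1.2, hyn⟩ b hb)
  · rintro v w - - ⟨A, hA, B, hB, hAB⟩
    exact ⟨B, hB, A, hA, fun a ha b hb => (hAB b hb a ha).symm⟩

end PlanarSystem.IsBasin

/-! ### Length lower bound and area upper bound for derivative sums -/

namespace PlanarSystem.IsBasin

variable {G : PlanarSystem} {N : ℕ} {p : ℂ} {V : Set ℂ}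

theorem exists_dist_le (G : PlanarSystem) : ∃ M > 0, ∀ a ∈ G.K, ∀ b ∈ G.K, dist a b ≤ M := by
  obtain ⟨M, hM⟩ := Metric.isBounded_iff.1 G.isCompact_K.isBounded
  exact ⟨max M 1, by positivity, fun a ha b hb => (hM ha hb).trans (le_max_left _ _)⟩

theorem diff_subset (h : G.IsBasin N p V) : V \ closure G.orb ⊆ interior G.K \ G.orb :=
  fun _ hv => ⟨h.mem_interior hv.1, fun h' => hv.2 (subset_closure h')⟩

theorem isOpen_diff (h : G.IsBasin N p V) : IsOpen (V \ closure G.orb) :=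
  h.isOpen.sdiff isClosed_closure

open Metric in
/-- The vertical line through a point of a small disc around the attracting point meets the
preimages of a circle around this point. -/
theorem exists_mem_fib_re_eq (h : G.IsBasin N p V) {r : ℝ} (hr : 0 < r)
    (hV : closedBall p r ⊆ V) :
    ∃ r' > 0, ∀ k, ∀ t ∈ Ioo (p.re - r') (p.re + r'), ∃ y ∈ sphere p r, ∃ v ∈ G.fib (N * k) y,
      v.re = t := by
  obtain ⟨M, hM0, hM⟩ := exists_dist_le G
  have hV' : ball p r ⊆ V := ball_subset_closedBall.trans hV
  -- By Schwarz every g^(Nk) expands distances from `p` by at most M/r, so the disc of radius r²/M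
  -- is sent into the disc of radius `r`.
  refine ⟨min r (r * r / M), by positivity, fun k t ht => ?_⟩
  have hfix : G.g^[N * k] p = p := by
    rw [Function.iterate_mul]
    exact Function.iterate_fixed h.fixed k
  set O := {v | v ∈ G.dom (N * k) ∧ G.g^[N * k] v ∈ ball p r} with hO
  have hOopen : IsOpen O := by
    rw [isOpen_iff_mem_nhds]
    rintro v ⟨hv, hvp⟩
    have hn := dom_mem_nhds hv (h.mem_interior (hV' hvp))
    exact inter_mem hn (((continuousOn_iterate _).continuousAt hn).preimage_mem_nhds
      (isOpen_ball.mem_nhds hvp))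
  have hball : ball p (min r (r * r / M)) ⊆ O := by
    intro v hv
    have hvr : v ∈ ball p r := ball_subset_ball (min_le_left _ _) hv
    refine ⟨h.subset _ (hV' hvr), ?_⟩
    have h1 := h.dist_iterate_le hV' hM (N * k) hvr
    rw [hfix] at h1
    have h2 : dist v p < r * r / M := lt_of_lt_of_le hv (min_le_right _ _)
    rw [mem_ball]
    calc _ ≤ M / r * dist v p := h1
      _ < M / r * (r * r / M) := by gcongr
      _ = r := by field_simp
  set l := {v : ℂ | v.re = t} with hl
  have hlc : IsPreconnected l := by
    refine Convex.isPreconnected ?_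
    exact (convex_singleton t).is_linear_preimage
      (IsLinearMap.mk Complex.add_re (fun c x => by simp))
  have hne1 : (l ∩ O).Nonempty := by
    refine ⟨⟨t, p.im⟩, rfl, hball ?_⟩
    rw [mem_ball, Complex.dist_eq_re_im]
    simp only [sub_self, ne_eq, OfNat.ofNat_ne_zero, not_false_eq_true, zero_pow, add_zero]
    rw [Real.sqrt_sq_eq_abs, abs_lt]
    constructor <;> linarith [ht.1, ht.2]
  have hne2 : (l ∩ Oᶜ).Nonempty := by
    -- This point is more than `M` above `p`, hence outside K.
    refine ⟨⟨t, p.im + M + 1⟩, rfl, fun hmem => ?_⟩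
    have h1 := hM _ hmem.1.1 p (h.subset 0 h.mem).1
    have h2 := Complex.abs_im_le_norm ((⟨t, p.im + M + 1⟩ : ℂ) - p)
    rw [← dist_eq_norm, Complex.sub_im] at h2
    have h3 := (le_abs_self _).trans (h2.trans h1)
    simp only at h3
    linarith
  obtain ⟨v, hvl, hvf⟩ : ∃ v ∈ l, v ∈ frontier O := by
    by_contra! hcon
    have hcl : ∀ v ∈ l, v ∉ O → v ∈ (closure O)ᶜ := fun v hv hvO hvc =>
      hcon v hv (by rw [hOopen.frontier_eq]; exact ⟨hvc, hvO⟩)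
    obtain ⟨w, hw, hwO⟩ := hne2
    obtain ⟨u, -, hu, hu'⟩ := hlc O (closure O)ᶜ hOopen isClosed_closure.isOpen_compl
      (fun v hv => (em (v ∈ O)).imp id (hcl v hv)) hne1 ⟨w, hw, hcl w hw hwO⟩
    exact hu' (subset_closure hu)
  have hcl : IsClosed (G.dom (N * k) ∩ G.g^[N * k] ⁻¹' closedBall p r) :=
    (continuousOn_iterate _).preimage_isClosed_of_isClosed (isCompact_dom _).isClosed
      isClosed_closedBall
  rw [hOopen.frontier_eq] at hvf
  have hOsub : O ⊆ G.dom (N * k) ∩ G.g^[N * k] ⁻¹' closedBall p r :=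
    fun w hw => ⟨hw.1, ball_subset_closedBall hw.2⟩
  have hv1 := closure_minimal hOsub hcl hvf.1
  refine ⟨G.g^[N * k] v, ?_, v, ⟨hv1.1, rfl⟩, hvl⟩
  have h1 : dist (G.g^[N * k] v) p ≤ r := hv1.2
  have h2 : ¬ dist (G.g^[N * k] v) p < r := fun hlt => hvf.2 ⟨hv1.1, hlt⟩
  exact le_antisymm h1 (not_lt.1 h2)

open Metric MeasureTheory in
-- The real parts of the preimages of a circle cover an interval of fixed length, while finitely
-- many Koebe discs on the circle pull back to pieces whose total length is controlled by the
-- derivative sums.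
theorem exists_le_wtSum (h : G.IsBasin N p V) {x : ℂ} (hx : x ∈ V \ closure G.orb) :
    ∃ c > 0, ∀ k, c ≤ G.wtSum (N * k) x := by
  obtain ⟨R, hR, hRV⟩ := Metric.isOpen_iff.1 h.isOpen p h.mem
  -- Only countably many radii give a circle meeting the postcritical set.
  obtain ⟨r, hr, hrn⟩ : ∃ r ∈ Ioo 0 R, r ∉ (fun y => dist y p) '' (closure G.orb ∩ V) := by
    by_contra! hcon
    exact (Cardinal.Real.Ioo_countable_iff.not.2 (not_le.2 hR)) ((h.countable_post.image _).mono hcon)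
  have hcV : closedBall p r ⊆ V := (closedBall_subset_ball hr.2).trans hRV
  obtain ⟨r', hr', hline⟩ := h.exists_mem_fib_re_eq hr.1 hcV
  have hsub : ∀ y ∈ sphere p r, y ∈ V \ closure G.orb := fun y hy =>
    ⟨hcV (sphere_subset_closedBall hy), fun hy' => hrn ⟨y, ⟨hy', hcV (sphere_subset_closedBall hy)⟩, hy⟩⟩
  choose! s hs0 hs using fun y (hy : y ∈ sphere p r) =>
    Metric.isOpen_iff.1 h.isOpen_diff y (hsub y hy)
  choose! C hC0 hC using fun y (hy : y ∈ sphere p r) => h.comparable (hsub y hy) hx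
  obtain ⟨t, htS, htc⟩ := (isCompact_sphere p r).elim_nhds_subcover (fun y => ball y (s y / 12))
    fun y hy => ball_mem_nhds y (by have := hs0 y hy; positivity)
  set D := ∑ y ∈ t, 48 * s y * C y with hD
  have hmain : ∀ k, 2 * r' ≤ D * G.wtSum (N * k) x := by
    intro k
    have hcov : Ioo (p.re - r') (p.re + r') ⊆ ⋃ y ∈ t, ⋃ w ∈ (G.finite_fib (N * k) y).toFinset,
        Icc (w.re - 24 * s y * G.wt (N * k) w) (w.re + 24 * s y * G.wt (N * k) w) := by
      intro u hu
      obtain ⟨y, hy, v, hv, rfl⟩ := hline k u hu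
      obtain ⟨ζ, hζ, hyζ⟩ := mem_iUnion₂.1 (htc hy)
      have hsζ := hs0 ζ (htS ζ hζ)
      have hB := (hs ζ (htS ζ hζ)).trans h.diff_subset
      obtain ⟨f, hf, hfy, -⟩ :=
        exists_section hB (ball_subset_ball (by linarith) hyζ) hv
      have hd := (hf.distortion hsζ hB).2.1 y hyζ
      rw [hfy] at hd
      refine mem_biUnion hζ (mem_iUnion₂.2 ⟨f ζ, ?_, ?_⟩)
      · rw [Set.Finite.mem_toFinset]
        exact hf.2 ζ (mem_ball_self hsζ)
      · have := abs_le.1 ((Complex.abs_re_le_norm (v - f ζ)).trans hd)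
        rw [Complex.sub_re] at this
        constructor <;> linarith [this.1, this.2]
    have hvol : ENNReal.ofReal (2 * r') ≤ ∑ y ∈ t, ∑ w ∈ (G.finite_fib (N * k) y).toFinset,
        ENNReal.ofReal (48 * s y * G.wt (N * k) w) := by
      calc ENNReal.ofReal (2 * r') = volume (Ioo (p.re - r') (p.re + r')) := by
            rw [Real.volume_Ioo]; congr 1; ring
        _ ≤ _ := measure_mono hcov
        _ ≤ _ := measure_biUnion_finset_le _ _
        _ ≤ _ := by
            refine Finset.sum_le_sum fun y _ => (measure_biUnion_finset_le _ _).trans ?_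
            refine Finset.sum_le_sum fun w _ => ?_
            rw [Real.volume_Icc]
            refine le_of_eq ?_
            congr 1; ring
    have hnn : ∀ y ∈ t, ∀ w ∈ (G.finite_fib (N * k) y).toFinset,
        0 ≤ 48 * s y * G.wt (N * k) w := by
      intro y hy w _
      have := hs0 y (htS y hy)
      have := wt_nonneg (G := G) (N * k) w
      positivity
    rw [Finset.sum_congr rfl fun y hy => (ENNReal.ofReal_sum_of_nonneg (hnn y hy)).symm,
      ← ENNReal.ofReal_sum_of_nonneg fun y hy => Finset.sum_nonneg (hnn y hy)] at hvol
    have hle := (ENNReal.ofReal_le_ofReal_iff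
      (Finset.sum_nonneg fun y hy => Finset.sum_nonneg (hnn y hy))).1 hvol
    refine hle.trans ?_
    rw [hD, Finset.sum_mul]
    refine Finset.sum_le_sum fun y hy => ?_
    rw [← Finset.mul_sum, mul_assoc (48 * s y)]
    have := hs0 y (htS y hy)
    gcongr
    exact (hC y (htS y hy) (N * k)).1
  have hDpos : 0 < D := by
    have h1 := hmain 0
    have h2 := wtSum_nonneg (G := G) (N * 0) x
    by_contra hD0
    nlinarith [mul_nonneg (neg_nonneg.2 (not_lt.1 hD0)) h2]
  refine ⟨2 * r' / D, by positivity, fun k => ?_⟩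
  rw [div_le_iff₀ hDpos, mul_comm _ D]
  exact hmain k

open Metric in
/-- The attracting point is postcritical. -/
theorem mem_closure_orb (h : G.IsBasin N p V) : p ∈ closure G.orb := by
  -- Otherwise inverse branches of all g^(Nk) fixing `p` exist on one disc. Their values at a nearby
  -- y ≠ p accumulate at some `v` in the basin. The iterates of `v` converge to `p`, yet
  -- equicontinuity brings them along a subsequence to `y`.
  by_contra hp
  obtain ⟨R, hR, hRV⟩ := Metric.isOpen_iff.1 h.isOpen_diff p ⟨h.mem, hp⟩
  obtain ⟨M, hM0, hM⟩ := exists_dist_le G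
  have hB := hRV.trans h.diff_subset
  have hV : ball p R ⊆ V := hRV.trans sdiff_subset
  have hpR : p ∈ ball p R := mem_ball_self hR
  have hfix : ∀ k, p ∈ G.fib (N * k) p := fun k => ⟨h.subset _ h.mem, by
    rw [Function.iterate_mul]; exact Function.iterate_fixed h.fixed k⟩
  choose f hf hfp _ using fun k => exists_section hB hpR (hfix k)
  have hlip : ∀ k, ∀ y ∈ ball p R, dist (f k y) p ≤ M / R * dist y p := by
    intro k y hy
    have := Complex.dist_le_div_mul_dist_of_mapsTo_ball (f := fun w => G.tw (N * k) (f k w))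
      (c := p) (R₁ := R) (R₂ := M)
      (fun w hw => ((hf k).hasDerivAt isOpen_ball hB hw).differentiableAt.differentiableWithinAt)
      (fun w hw => by
        rw [mem_closedBall, (G.isometry_tw _).dist_eq]
        exact hM _ ((hf k).2 w hw).1.1 _ ((hf k).2 p hpR).1.1) hy
    rwa [(G.isometry_tw _).dist_eq, hfp] at this
  obtain ⟨y, hyp, hyR, hyM⟩ : ∃ y, y ≠ p ∧ y ∈ ball p R ∧ M / R * dist y p ≤ R / 2 := by
    set δ := min (R / 2) (R * R / (2 * M)) with hδ
    have hδ0 : 0 < δ := by positivity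
    have hd : dist (p + (δ : ℂ)) p = δ := by
      rw [dist_eq_norm, add_sub_cancel_left, Complex.norm_real, Real.norm_of_nonneg hδ0.le]
    refine ⟨p + (δ : ℂ), ?_, ?_, ?_⟩
    · rw [← dist_pos, hd]; exact hδ0
    · rw [mem_ball, hd]
      exact (min_le_left _ _).trans_lt (by linarith)
    · rw [hd]
      calc M / R * δ ≤ M / R * (R * R / (2 * M)) := by gcongr; exact min_le_right _ _
        _ = R / 2 := by field_simp
  have hmem : ∀ k, f k y ∈ closedBall p (R / 2) := fun k => (hlip k y hyR).trans hyM
  obtain ⟨v, hv, φ, hφ, hlim⟩ := (isCompact_closedBall p (R / 2)).tendsto_subseq hmem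
  have hvV : ball v (R / 2) ⊆ V := by
    refine (ball_subset_ball' ?_).trans hV
    have : dist v p ≤ R / 2 := hv
    linarith
  have hvV' : v ∈ V := hvV (mem_ball_self (by positivity))
  have h1 : Tendsto (fun j => G.g^[N * φ j] v) atTop (𝓝 p) := by
    have := (h.tendsto' hvV' 0).comp hφ.tendsto_atTop
    simpa [Function.comp_def] using this
  have h2 : Tendsto (fun j => M / (R / 2) * dist (f (φ j) y) v) atTop (𝓝 0) := by
    have := (tendsto_iff_dist_tendsto_zero.1 hlim).const_mul (M / (R / 2))
    simpa using this
  have h3 : Tendsto (fun j => dist y (G.g^[N * φ j] v)) atTop (𝓝 0) := by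
    refine squeeze_zero' (Eventually.of_forall fun _ => dist_nonneg) ?_ h2
    filter_upwards [hlim.eventually (ball_mem_nhds v (show 0 < R / 2 by positivity))] with j hj
    have := h.dist_iterate_le hvV hM (N * φ j) hj
    rwa [Function.comp, ((hf (φ j)).2 y hyR).2] at this
  have h4 : Tendsto (fun j => G.g^[N * φ j] v) atTop (𝓝 y) := by
    rw [tendsto_iff_dist_tendsto_zero]
    simpa only [dist_comm] using h3
  exact hyp (tendsto_nhds_unique h4 h1)

open Metric in
/-- A point outside the postcritical set has a neighbourhood which never returns to itself. -/
theorem exists_wandering (h : G.IsBasin N p V) {x : ℂ} (hx : x ∈ V \ closure G.orb) :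
    ∃ r > 0, ball x r ⊆ V \ closure G.orb ∧
      ∀ i, ∀ y ∈ ball x r, G.g^[i + 1] y ∉ ball x r := by
  have hxp : x ≠ p := by
    rintro rfl
    exact hx.2 h.mem_closure_orb
  obtain ⟨A, hA, -, hAi, hAm⟩ := h.exists_isClosed_orbit hx.1
  -- A periodic point whose orbit tends to `p` along multiples of `N` must be `p`, which is excluded
  -- as postcritical.
  have hper : ∀ i, G.g^[i + 1] x ≠ x := by
    intro i hi
    have h1 : Tendsto (fun k => G.g^[0 + N * ((i + 1) * k)] x) atTop (𝓝 p) :=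
      (h.tendsto' hx.1 0).comp (tendsto_id.const_mul_atTop' (Nat.succ_pos i))
    have h2 : ∀ k, G.g^[0 + N * ((i + 1) * k)] x = x := by
      intro k
      rw [show 0 + N * ((i + 1) * k) = (i + 1) * (N * k) by ring, Function.iterate_mul]
      exact Function.iterate_fixed hi _
    simp only [h2] at h1
    exact hxp (tendsto_nhds_unique tendsto_const_nhds h1)
  have hxA : x ∉ A := by
    intro hxA
    rcases hAm x hxA with ⟨m, hm⟩ | ⟨i, hi⟩
    · refine hper (N - 1) ?_
      rw [Nat.sub_add_cancel h.pos, hm, ← Function.iterate_add_apply, add_comm,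
        Function.iterate_add_apply, h.fixed]
    · exact hper i hi.symm
  obtain ⟨δ, hδ, hδA⟩ := Metric.isOpen_iff.1 hA.isOpen_compl x hxA
  obtain ⟨R, hR, hRV⟩ := Metric.isOpen_iff.1 h.isOpen_diff x hx
  obtain ⟨M, hM0, hM⟩ := exists_dist_le G
  refine ⟨min R (min (δ / 2) (δ / 2 * R / M)), by positivity,
    (ball_subset_ball (min_le_left _ _)).trans hRV, fun i y hy hy' => ?_⟩
  have hyR : y ∈ ball x R := ball_subset_ball (min_le_left _ _) hy
  have h1 := h.dist_iterate_le (hRV.trans sdiff_subset) hM (i + 1) hyR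
  have h2 : dist y x < δ / 2 * R / M :=
    lt_of_lt_of_le hy ((min_le_right _ _).trans (min_le_right _ _))
  have h3 : dist (G.g^[i + 1] y) x < δ / 2 :=
    lt_of_lt_of_le hy' ((min_le_right _ _).trans (min_le_left _ _))
  have h4 : dist (G.g^[i + 1] y) (G.g^[i + 1] x) < δ / 2 := by
    calc _ ≤ M / R * dist y x := h1
      _ < M / R * (δ / 2 * R / M) := by gcongr
      _ = δ / 2 := by field_simp
  refine hδA (mem_ball.2 ?_) (hAi i)
  linarith [dist_triangle_left (G.g^[i + 1] x) x (G.g^[i + 1] y)]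

open Metric MeasureTheory in
-- An area count: the Koebe discs inside the images of a wandering disc under all inverse branches
-- are disjoint subsets of K.
theorem tsum_wt_sq_lt_top (h : G.IsBasin N p V) {x : ℂ} (hx : x ∈ V \ closure G.orb) :
    ∑' k, ∑' v : G.fib k x, ENNReal.ofReal (G.wt k v) ^ 2 < ⊤ := by
  obtain ⟨r, hr, hrV, hwand⟩ := h.exists_wandering hx
  have hB := hrV.trans h.diff_subset
  have hxr : x ∈ ball x r := mem_ball_self hr
  choose f hf hfx _ using fun (a : Σ k, G.fib k x) => exists_section hB hxr a.2.2
  set E : (Σ k, G.fib k x) → Set ℂ := fun a => ball (a.2 : ℂ) (r * G.wt a.1 a.2 / 288) with hE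
  have hsub : ∀ a, E a ⊆ f a '' ball x r := fun a => by
    have := ((hf a).distortion hr hB).1
    rwa [hfx] at this
  -- At different levels an overlap would make some point of the disc return to it; at the same
  -- level it would make two branches agree at a point, hence everywhere.
  have hdisj : Pairwise (Function.onFun Disjoint E) := by
    have hlt : ∀ a b : (Σ k, G.fib k x), a.1 < b.1 → Disjoint (E a) (E b) := by
      intro a b hab
      rw [Set.disjoint_left]
      intro w hwa hwb
      obtain ⟨y, hy, rfl⟩ := hsub a hwa
      obtain ⟨y', hy', hyy'⟩ := hsub b hwb
      refine hwand (b.1 - a.1 - 1) y hy ?_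
      have e1 := ((hf a).2 y hy).2
      have e2 := ((hf b).2 y' hy').2
      rw [hyy', show b.1 = (b.1 - a.1 - 1 + 1) + a.1 by omega, Function.iterate_add_apply,
        e1] at e2
      rwa [e2]
    rintro ⟨k, v⟩ ⟨k', v'⟩ hne
    rcases lt_trichotomy k k' with hk | rfl | hk
    · exact hlt ⟨k, v⟩ ⟨k', v'⟩ hk
    · rw [Function.onFun, Set.disjoint_left]
      intro w hwa hwb
      obtain ⟨y, hy, rfl⟩ := hsub _ hwa
      obtain ⟨y', hy', hyy'⟩ := hsub _ hwb
      have e1 := ((hf ⟨k, v⟩).2 y hy).2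
      have e2 := ((hf ⟨k, v'⟩).2 y' hy').2
      have hyeq : y' = y := by rw [← e2, hyy']; exact e1
      subst hyeq
      have := (hf ⟨k, v⟩).eqOn hB (hf ⟨k, v'⟩) hy hyy'.symm hxr
      rw [hfx, hfx] at this
      exact hne (by rw [show v = v' from Subtype.ext this])
    · exact (hlt ⟨k', v'⟩ ⟨k, v⟩ hk).symm
  have hEK : (⋃ a, E a) ⊆ G.K := by
    refine iUnion_subset fun a => (hsub a).trans ?_
    rintro _ ⟨y, hy, rfl⟩
    exact ((hf a).2 y hy).1.1
  have : ∀ k, Countable (G.fib k x) := fun k => (finite_fib k x).countable.to_subtype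
  have hvol : ∑' a, volume (E a) < ⊤ := by
    rw [← measure_iUnion hdisj fun a => isOpen_ball.measurableSet]
    exact (measure_mono hEK).trans_lt G.isCompact_K.measure_lt_top
  have hEv : ∀ a, volume (E a) = (ENNReal.ofReal (r / 288) ^ 2 * NNReal.pi) *
      ENNReal.ofReal (G.wt a.1 a.2) ^ 2 := by
    intro a
    rw [hE, Complex.volume_ball, show r * G.wt a.1 a.2 / 288 = r / 288 * G.wt a.1 a.2 by ring,
      ENNReal.ofReal_mul (by positivity), mul_pow]
    ring
  simp only [hEv] at hvol
  rw [ENNReal.tsum_mul_left, ENNReal.tsum_sigma'] at hvol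
  refine ENNReal.lt_top_of_mul_ne_top_right hvol.ne ?_
  refine mul_ne_zero (pow_ne_zero _ ?_) ?_
  · rw [ne_eq, ENNReal.ofReal_eq_zero, not_le]; positivity
  · simpa using NNReal.pi_pos.ne'

end PlanarSystem.IsBasin

/-! ### Roots of bivariate polynomials and regularity of the inverse map -/

section Bivariate

open Polynomial Polynomial.Bivariate

theorem evalEval_swap (p : ℂ[X][Y]) (x y : ℂ) :
    (Bivariate.swap p).evalEval x y = p.evalEval y x := by
  simpa only [coe_aevalAeval_eq_evalEval] using Bivariate.aevalAeval_swap x y p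

theorem differentiable_evalEval (p : ℂ[X][Y]) :
    Differentiable ℂ fun z : ℂ × ℂ => p.evalEval z.1 z.2 := by
  have h : (fun z : ℂ × ℂ => p.evalEval z.1 z.2) =
      fun z => ∑ i ∈ Finset.range (p.natDegree + 1), (p.coeff i).eval z.1 * z.2 ^ i := by
    funext z
    rw [evalEval, eval_eq_sum_range (p := p), eval_finsetSum]
    simp
  rw [h]
  refine Differentiable.fun_sum fun i _ => ?_
  exact ((p.coeff i).differentiable.comp differentiable_fst).mul (differentiable_snd.pow i)

theorem continuous_evalEval (p : ℂ[X][Y]) : Continuous fun z : ℂ × ℂ => p.evalEval z.1 z.2 :=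
  (differentiable_evalEval p).continuous

theorem hasDerivAt_evalEval_snd (p : ℂ[X][Y]) (x y : ℂ) :
    HasDerivAt (fun t => p.evalEval x t) ((derivative p).evalEval x y) y := by
  have h : ∀ q : ℂ[X][Y], ∀ t, q.evalEval x t = (q.map (evalRingHom x)).eval t := by
    intro q t
    rw [← eval₂_evalRingHom, eval_map]
  simp only [h]
  rw [← derivative_map]
  exact Polynomial.hasDerivAt _ _

theorem exists_map_eq_C_mul (F : (FractionRing ℂ[X])[X]) :
    ∃ s : ℂ[X], s ≠ 0 ∧ ∃ f : ℂ[X][Y],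
      f.map (algebraMap ℂ[X] (FractionRing ℂ[X])) = C (algebraMap ℂ[X] (FractionRing ℂ[X]) s) * F := by
  obtain ⟨b, hb, h⟩ := IsLocalization.integerNormalization_spec (nonZeroDivisors ℂ[X]) F
  refine ⟨b, nonZeroDivisors.ne_zero hb, _, h.trans ?_⟩
  rw [← Polynomial.smul_eq_C_mul, algebraMap_smul]

/-- Away from finitely many vertical lines, the zero set of a bivariate polynomial is contained in
that of a polynomial whose vertical derivative does not vanish there. -/
theorem exists_separable_of_ne_zero {p : ℂ[X][Y]} (hp : p ≠ 0) :
    ∃ q : ℂ[X][Y], ∃ E : Set ℂ, E.Finite ∧ ∀ x ∉ E, ∀ y, p.evalEval x y = 0 →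
      q.evalEval x y = 0 ∧ (derivative q).evalEval x y ≠ 0 := by
  classical
  set ι := algebraMap ℂ[X] (FractionRing ℂ[X]) with hι
  have hιi : Function.Injective ι := IsFractionRing.injective _ _
  have hmi : Function.Injective (Polynomial.map ι) := Polynomial.map_injective ι hιi
  set P := p.map ι with hP
  have hP0 : P ≠ 0 := by
    rw [hP, Ne, Polynomial.map_eq_zero_iff hιi]; exact hp
  set Q := UniqueFactorizationMonoid.radical P with hQ
  obtain ⟨n, T, hT⟩ := UniqueFactorizationMonoid.exists_dvd_radical_self_pow hP0
  rw [← hQ] at hT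
  have hsep : Q.Separable :=
    PerfectField.separable_iff_squarefree.2 UniqueFactorizationMonoid.squarefree_radical
  obtain ⟨A, B, hAB⟩ := hsep
  obtain ⟨s, hs, q, hq⟩ := exists_map_eq_C_mul Q
  obtain ⟨sA, hsA, a, ha⟩ := exists_map_eq_C_mul A
  obtain ⟨sB, hsB, b, hb⟩ := exists_map_eq_C_mul B
  obtain ⟨sT, hsT, t, ht⟩ := exists_map_eq_C_mul T
  rw [← hι] at hq ha hb ht
  have hq' : (derivative q).map ι = C (ι s) * derivative Q := by
    rw [← derivative_map, hq, derivative_C_mul]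
  -- The Bézout identity for the radical and its derivative over the field of rational functions,
  -- with denominators cleared. `E` consists of the zeros of the cleared factors.
  have h1 : C sB * a * q + C sA * b * derivative q = C (sA * sB * s) := by
    apply hmi
    simp only [Polynomial.map_add, Polynomial.map_mul, map_C, hq, ha, hb, hq', map_mul]
    linear_combination (C (ι sA) * C (ι sB) * C (ι s)) * hAB
  have h2 : C sT * q ^ n = C (s ^ n) * p * t := by
    apply hmi
    simp only [Polynomial.map_pow, Polynomial.map_mul, map_C, hq, ht, map_pow, mul_pow]
    rw [← hP]
    linear_combination (C (ι sT) * C (ι s) ^ n) * hT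
  refine ⟨q, {x | (sA * sB * s * sT).IsRoot x}, Polynomial.finite_setOfPred_isRoot (by
    simp [hs, hsA, hsB, hsT]), fun x hx y hpxy => ?_⟩
  simp only [mem_ofPred_eq, IsRoot.def, eval_mul, mul_eq_zero, not_or] at hx
  have hq0 : q.evalEval x y = 0 := by
    have := congrArg (evalEval x y) h2
    simp only [evalEval_mul, evalEval_pow, evalEval_C, hpxy, mul_zero, zero_mul] at this
    exact eq_zero_of_pow_eq_zero ((mul_eq_zero.1 this).resolve_left hx.2)
  refine ⟨hq0, fun hd => ?_⟩
  have := congrArg (evalEval x y) h1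
  simp only [evalEval_mul, evalEval_add, evalEval_C, hq0, hd, mul_zero, add_zero, eval_mul] at this
  exact mul_ne_zero (mul_ne_zero hx.1.1.1 hx.1.1.2) hx.1.2 this.symm

/-- A continuous root of a bivariate polynomial is differentiable where it is a simple root. -/
theorem differentiableAt_of_evalEval_eq_zero {q : ℂ[X][Y]} {h : ℂ → ℂ} {x₀ : ℂ}
    (hc : ContinuousAt h x₀) (hz : ∀ᶠ x in 𝓝 x₀, q.evalEval x (h x) = 0)
    (hd : (derivative q).evalEval x₀ (h x₀) ≠ 0) : DifferentiableAt ℂ h x₀ := by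
  set y₀ := h x₀ with hy₀
  -- Writing q = (Y - y₀)s + (X - x₀)k turns the difference quotient of `h` into -k/s, which is
  -- continuous at `x₀` because `s` is nonzero there.
  obtain ⟨s, hs⟩ : (X - C (C y₀)) ∣ q - C (q.eval (C y₀)) := by
    rw [dvd_iff_isRoot]; simp
  set r := q.eval (C y₀) with hr
  have hr0 : r.IsRoot x₀ := by
    have := hz.self_of_nhds
    exact this
  obtain ⟨k, hk⟩ := dvd_iff_isRoot.2 hr0
  have hq : q = (X - C (C y₀)) * s + C r := by rw [← hs]; ring
  have hsd : s.evalEval x₀ y₀ ≠ 0 := by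
    intro h0
    apply hd
    rw [hq]
    simp [derivative_mul, h0, evalEval_add, evalEval_mul, evalEval_sub]
  have hsc : ContinuousAt (fun x => s.evalEval x (h x)) x₀ :=
    (continuous_evalEval s).continuousAt.comp (f := fun x => (x, h x)) (continuousAt_id.prodMk hc)
  have hslope : Tendsto (fun x => -(k.eval x) / s.evalEval x (h x)) (𝓝[≠] x₀)
      (𝓝 (-(k.eval x₀) / s.evalEval x₀ y₀)) :=
    ((k.continuous.continuousAt.neg.div hsc hsd).tendsto).mono_left nhdsWithin_le_nhds
  refine (hasDerivAt_iff_tendsto_slope.2 (hslope.congr' ?_)).differentiableAt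
  filter_upwards [self_mem_nhdsWithin, nhdsWithin_le_nhds hz,
    nhdsWithin_le_nhds (hsc.eventually_ne hsd)] with x hx hzx hsx
  rw [slope_def_field, ← hy₀]
  have hx' : x - x₀ ≠ 0 := sub_ne_zero.2 hx
  rw [hq] at hzx
  simp only [evalEval_add, evalEval_mul, evalEval_sub, evalEval_X, evalEval_C, eval_C, hk,
    eval_mul, eval_sub, eval_X] at hzx
  rw [div_eq_div_iff hsx hx']
  linear_combination -hzx

/-- At a critical point of a root function, the vertical derivative of the polynomial vanishes. -/
theorem derivative_evalEval_eq_zero {q : ℂ[X][Y]} {h : ℂ → ℂ} {v : ℂ} (hh : HasDerivAt h 0 v)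
    (hz : ∀ᶠ w in 𝓝 v, q.evalEval (h w) w = 0) : (derivative q).evalEval (h v) v = 0 := by
  -- As h'(v) = 0, the curve w ↦ (h w, w) and the vertical line have the same velocity at `v`; `q`
  -- is constant along the curve.
  have hF := (differentiable_evalEval q (h v, v)).hasFDerivAt
  have h1 : HasDerivAt (fun w => q.evalEval (h w) w) _ v :=
    hF.comp_hasDerivAt (f := fun w => (h w, w)) v (hh.prodMk (hasDerivAt_id v))
  have h2 : HasDerivAt (fun w => q.evalEval (h v) w) _ v :=
    hF.comp_hasDerivAt (f := fun w => (h v, w)) v ((hasDerivAt_const v (h v)).prodMk (hasDerivAt_id v))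
  have h3 : HasDerivAt (fun w => q.evalEval (h w) w) 0 v :=
    (hasDerivAt_const v 0).congr_of_eventuallyEq hz
  exact (hasDerivAt_evalEval_snd q (h v) v).unique (h2.congr_deriv (h1.unique h3))

/-- Roots of a polynomial depend continuously on parameters. -/
theorem eventually_exists_root {p : ℂ[X][Y]} {u₀ v₀ : ℂ} (h0 : p.evalEval u₀ v₀ = 0)
    (hne : ∃ u, p.evalEval u v₀ ≠ 0) {A : Set ℂ} (hA : A ∈ 𝓝 u₀) :
    ∀ᶠ v in 𝓝 v₀, ∃ u ∈ A, p.evalEval u v = 0 := by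
  have hdiff : ∀ v, Differentiable ℂ fun u => p.evalEval u v := fun v =>
    (differentiable_evalEval p).comp (differentiable_id.prodMk (differentiable_const v))
  have han : AnalyticOnNhd ℂ (fun u => p.evalEval u v₀) univ := fun u _ =>
    (hdiff v₀).analyticAt u
  have hiso : ∀ᶠ u in 𝓝[≠] u₀, p.evalEval u v₀ ≠ 0 := by
    refine (han u₀ trivial).eventually_eq_zero_or_eventually_ne_zero.resolve_left fun hz => ?_
    obtain ⟨u, hu⟩ := hne
    exact hu (han.eqOn_zero_of_preconnected_of_eventuallyEq_zero isPreconnected_univ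
      (mem_univ u₀) hz (mem_univ u))
  obtain ⟨ρ, hρ, hρA, hρz⟩ : ∃ ρ > 0, Metric.closedBall u₀ ρ ⊆ A ∧
      ∀ u ∈ Metric.sphere u₀ ρ, p.evalEval u v₀ ≠ 0 := by
    obtain ⟨a, ha, haA⟩ := Metric.nhds_basis_closedBall.mem_iff.1 hA
    obtain ⟨b, hb, hbz⟩ := Metric.mem_nhdsWithin_iff.1 hiso
    refine ⟨min a (b / 2), by positivity,
      (Metric.closedBall_subset_closedBall (min_le_left _ _)).trans haA, fun u hu => ?_⟩
    have hd : dist u u₀ = min a (b / 2) := hu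
    refine hbz ⟨?_, ?_⟩
    · rw [Metric.mem_ball, hd]
      exact (min_le_right _ _).trans_lt (by linarith)
    · rintro rfl
      rw [dist_self] at hd
      have : 0 < min a (b / 2) := by positivity
      linarith
  have hnes : (Metric.sphere u₀ ρ).Nonempty := NormedSpace.sphere_nonempty.2 hρ.le
  obtain ⟨w, hw, hwm⟩ := (isCompact_sphere u₀ ρ).exists_isMinOn hnes
    ((hdiff v₀).continuous.norm.continuousOn)
  set m := ‖p.evalEval w v₀‖ with hm
  have hm0 : 0 < m := norm_pos_iff.2 (hρz w hw)
  have hcont : Continuous fun z : ℂ × ℂ => ‖p.evalEval z.2 z.1‖ :=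
    ((continuous_evalEval p).comp continuous_swap).norm
  have e1 : ∀ᶠ v in 𝓝 v₀, ∀ u ∈ Metric.sphere u₀ ρ, m / 2 < ‖p.evalEval u v‖ := by
    refine (isCompact_sphere u₀ ρ).eventually_forall_of_forall_eventually fun u hu => ?_
    refine hcont.continuousAt.eventually_const_lt ?_
    have := hwm hu
    simp only [mem_ofPred_eq] at this
    simp only
    linarith
  have e2 : ∀ᶠ v in 𝓝 v₀, ‖p.evalEval u₀ v‖ < m / 2 := by
    have : ContinuousAt (fun v => ‖p.evalEval u₀ v‖) v₀ :=
      (hcont.comp (continuous_id.prodMk continuous_const)).continuousAt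
    refine this.eventually_lt_const ?_
    simp only [h0, norm_zero]; positivity
  filter_upwards [e1, e2] with v hv1 hv2
  by_contra! hcon
  have hne' : ∀ u ∈ Metric.closedBall u₀ ρ, p.evalEval u v ≠ 0 := fun u hu => hcon u (hρA hu)
  -- Without a zero, the maximum principle for 1/p bounds |p| below by m/2 at the centre, against
  -- `hv2`.
  have hinv : DiffContOnCl ℂ (fun u => (p.evalEval u v)⁻¹) (Metric.ball u₀ ρ) := by
    refine DifferentiableOn.diffContOnCl ?_
    rw [closure_ball u₀ hρ.ne']
    exact fun u hu => ((hdiff v u).inv (hne' u hu)).differentiableWithinAt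
  have := Complex.norm_le_of_forall_mem_frontier_norm_le Metric.isBounded_ball hinv
    (C := (m / 2)⁻¹) (fun u hu => by
      rw [frontier_ball u₀ hρ.ne'] at hu
      rw [norm_inv]
      exact inv_anti₀ (by positivity) (hv1 u hu).le) (subset_closure (Metric.mem_ball_self hρ))
  rw [norm_inv, inv_le_inv₀ (norm_pos_iff.2 (hne' u₀ (Metric.mem_closedBall_self hρ.le)))
    (by positivity)] at this
  linarith

/-- An inverse-like polynomial correspondence in the plane. -/
theorem exists_planarSystem {b : Bool} {p : ℂ[X][Y]} {K L : Set ℂ} {g : ℂ → ℂ} (hK : IsCompact K)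
    (hK2 : K.Nonempty) (hL : ∀ v, v ∈ L ↔ ∃ u ∈ K, p.evalEval (conjIf b u) v = 0) (hLK : L ⊆ K)
    (hg : ∀ v ∈ L, g v ∈ K ∧ p.evalEval (conjIf b (g v)) v = 0)
    (huniq : ∀ u ∈ K, ∀ v, p.evalEval (conjIf b u) v = 0 → u = g v)
    (hvert : ∀ u ∈ K, ∃ v, p.evalEval (conjIf b u) v ≠ 0) :
    ∃ G : PlanarSystem, G.anti = b ∧ G.K = K ∧ G.L = L ∧ G.g = g := by
  have hconj := (isometry_conjIf b).continuous
  have hp0 : p ≠ 0 := by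
    rintro rfl
    obtain ⟨u, hu⟩ := hK2
    obtain ⟨v, hv⟩ := hvert u hu
    exact hv (by simp)
  set Γ : Set (ℂ × ℂ) := {z | p.evalEval (conjIf b z.1) z.2 = 0} with hΓ
  have hΓc : IsClosed Γ := isClosed_eq ((continuous_evalEval p).comp
    ((hconj.comp continuous_fst).prodMk continuous_snd)) continuous_const
  -- The preimage under g of a closed set is the projection of a compact piece of the graph; this
  -- gives compactness of L and continuity of g.
  have himg : ∀ C : Set ℂ, IsClosed C → IsCompact (Prod.snd '' ((K ∩ C) ×ˢ K ∩ Γ)) := fun C hC =>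
    (((hK.inter_right hC).prod hK).inter_right hΓc).image continuous_snd
  have hpre : ∀ C : Set ℂ, IsClosed C → IsCompact (L ∩ g ⁻¹' C) := by
    intro C hC
    convert himg C hC using 1
    ext v
    constructor
    · rintro ⟨hv, hvC⟩
      exact ⟨(g v, v), ⟨⟨⟨(hg v hv).1, hvC⟩, hLK hv⟩, (hg v hv).2⟩, rfl⟩
    · rintro ⟨⟨u, v⟩, ⟨⟨⟨hu, huC⟩, -⟩, huv⟩, rfl⟩
      refine ⟨(hL v).2 ⟨u, hu, huv⟩, ?_⟩
      rw [mem_preimage, ← huniq u hu v huv]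
      exact huC
  have hLc : IsCompact L := by simpa using hpre univ isClosed_univ
  have hcont : ContinuousOn g L := by
    rw [continuousOn_iff_isClosed]
    intro C hC
    refine ⟨L ∩ g ⁻¹' C, (hpre C hC).isClosed, ?_⟩
    ext v; simp only [mem_inter_iff, mem_preimage]; tauto
  have hrep : ∀ v ∈ interior L, ContinuousAt (fun w => conjIf b (g w)) v := fun v hv =>
    hconj.continuousAt.comp (hcont.continuousAt (mem_interior_iff_mem_nhds.1 hv))
  have hdiff : ∀ v ∈ interior L, DifferentiableAt ℂ (fun w => conjIf b (g w)) v := by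
    have hs0 : Bivariate.swap p ≠ 0 := by
      rw [Ne, EmbeddingLike.map_eq_zero_iff]; exact hp0
    obtain ⟨q, E, hE, hq⟩ := exists_separable_of_ne_zero hs0
    have hoff : ∀ v ∈ interior L, v ∉ E → DifferentiableAt ℂ (fun w => conjIf b (g w)) v := by
      intro v hv hvE
      have hroot : ∀ w ∈ L, (Bivariate.swap p).evalEval w (conjIf b (g w)) = 0 := fun w hw => by
        rw [evalEval_swap]; exact (hg w hw).2
      refine differentiableAt_of_evalEval_eq_zero (q := q) (hrep v hv) ?_
        (hq v hvE _ (hroot v (interior_subset hv))).2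
      filter_upwards [mem_interior_iff_mem_nhds.1 hv, hE.isClosed.isOpen_compl.mem_nhds hvE]
        with w hw hwE using (hq w hwE _ (hroot w hw)).1
    intro v hv
    -- The finitely many exceptional points are removable since the map is continuous there.
    refine (Complex.analyticAt_of_differentiable_on_punctured_nhds_of_continuousAt ?_
      (hrep v hv)).differentiableAt
    have hfin : (E \ {v}).Finite := hE.subset sdiff_subset
    have hn : (E \ {v})ᶜ ∈ 𝓝 v := hfin.isClosed.isOpen_compl.mem_nhds (by simp)
    filter_upwards [self_mem_nhdsWithin, nhdsWithin_le_nhds hn,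
      nhdsWithin_le_nhds (isOpen_interior.mem_nhds hv)] with w hwv hwE hw
    exact hoff w hw fun h => hwE ⟨h, hwv⟩
  refine ⟨{ anti := b, K := K, L := L, g := g, isCompact_K := hK, isCompact_L := hLc
            L_subset := hLK, mapsTo := fun v hv => (hg v hv).1, continuousOn := hcont
            differentiableAt := hdiff, mem_interior := ?_, finite_fiber := ?_
            finite_crit := ?_ }, rfl, rfl, rfl, rfl⟩
  · intro v hv hgv
    -- By uniqueness in K, a second point of K is not a root over `v`; so the polynomial in the
    -- first variable is not identically zero, as persistence of roots requires.
    obtain ⟨u, hu, hug⟩ : ∃ u ∈ K, u ≠ g v := by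
      by_contra! hcon
      have : interior K ⊆ {g v} := fun u hu => hcon u (interior_subset hu)
      have h1 := (isOpen_interior.mem_nhds hgv)
      exact infinite_of_mem_nhds _ h1 ((finite_singleton _).subset this)
    have hA : conjIf b ⁻¹' K ∈ 𝓝 (conjIf b (g v)) := by
      refine hconj.continuousAt.preimage_mem_nhds ?_
      rw [conjIf_involutive]
      exact mem_interior_iff_mem_nhds.1 hgv
    rw [mem_interior_iff_mem_nhds]
    filter_upwards [eventually_exists_root (hg v hv).2
      ⟨conjIf b u, fun h0 => hug (huniq u hu v h0)⟩ hA] with w hw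
    obtain ⟨u', hu', h0⟩ := hw
    refine (hL w).2 ⟨conjIf b u', hu', ?_⟩
    rw [conjIf_involutive]; exact h0
  · intro u
    by_cases hu : u ∈ K
    · obtain ⟨v₁, hv₁⟩ := hvert u hu
      have hne : p.map (evalRingHom (conjIf b u)) ≠ 0 := by
        intro h0
        apply hv₁
        rw [← eval₂_evalRingHom, ← eval_map, h0, eval_zero]
      refine (Polynomial.finite_setOfPred_isRoot hne).subset ?_
      rintro v ⟨hv, hvu⟩
      rw [mem_preimage, mem_singleton_iff] at hvu
      rw [mem_ofPred_eq, IsRoot.def, eval_map, eval₂_evalRingHom, ← hvu]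
      exact (hg v hv).2
    · convert finite_empty
      rw [eq_empty_iff_forall_notMem]
      rintro v ⟨hv, rfl⟩
      exact hu (hg v hv).1
  · obtain ⟨q, E, hE, hq⟩ := exists_separable_of_ne_zero hp0
    -- Off `E` the vertical derivative of `q` is nonzero on the curve, whereas at a critical point
    -- it vanishes.
    refine (hE.image (conjIf b)).subset ?_
    rintro _ ⟨v, hv, hv0, rfl⟩
    by_contra hvE
    have hvE' : conjIf b (g v) ∉ E := fun h => hvE ⟨_, h, conjIf_involutive b _⟩
    refine (hq _ hvE' v (hg v (interior_subset hv)).2).2 ?_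
    have hd := (hdiff v hv).hasDerivAt
    rw [hv0] at hd
    refine derivative_evalEval_eq_zero (h := fun w => conjIf b (g w)) hd ?_
    filter_upwards [isOpen_interior.mem_nhds hv,
      (hrep v hv).eventually_mem (hE.isClosed.isOpen_compl.mem_nhds hvE')] with w hw hwE
    exact (hq _ hwE w (hg w (interior_subset hw)).2).1

end Bivariate

/-! ### Critical points prevent local injectivity -/

/-- An analytic function that is injective near a point has nonzero derivative there. -/
theorem deriv_ne_zero_of_injOn {h : ℂ → ℂ} {v : ℂ} (ha : AnalyticAt ℂ h v) {A : Set ℂ}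
    (hA : A ∈ 𝓝 v) (hinj : InjOn h A) : deriv h v ≠ 0 := by
  intro h0
  have hne : ¬ ∀ᶠ z in 𝓝 v, h z - h v = 0 := by
    intro hev
    refine infinite_of_mem_nhds v (inter_mem hev hA) ((finite_singleton v).subset ?_)
    rintro z ⟨hz, hzA⟩
    exact hinj hzA (mem_of_mem_nhds hA) (sub_eq_zero.1 hz)
  obtain ⟨n, k, hk, hkv, hfac⟩ :=
    ((ha.sub analyticAt_const).exists_eventuallyEq_pow_smul_nonzero_iff).2 hne
  have hn0 : n ≠ 0 := by
    rintro rfl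
    have := hfac.self_of_nhds
    simp at this
    exact hkv this.symm
  have hn1 : n ≠ 1 := by
    rintro rfl
    have hd : HasDerivAt (fun z => (z - v) * k z) (k v) v := by
      simpa using ((hasDerivAt_id v).sub_const v).fun_mul hk.differentiableAt.hasDerivAt
    have hd' : HasDerivAt (fun z => h z - h v) 0 v := by
      simpa [h0] using ha.differentiableAt.hasDerivAt.sub_const (h v)
    have := (hd.congr_of_eventuallyEq (by
      filter_upwards [hfac] with z hz
      simpa using hz)).unique hd'
    exact hkv this
  -- an analytic `n`-th root of `k`
  obtain ⟨l, hl, hlv, hlk⟩ : ∃ l : ℂ → ℂ, AnalyticAt ℂ l v ∧ l v ≠ 0 ∧ ∀ᶠ z in 𝓝 v, l z ^ n = k z := by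
    refine ⟨fun z => Complex.exp ((Complex.log (k z / k v) + Complex.log (k v)) / n), ?_,
      Complex.exp_ne_zero _, ?_⟩
    · have h1 : AnalyticAt ℂ (fun z => Complex.log (k z / k v)) v := by
        refine AnalyticAt.clog (hk.div_const) ?_
        rw [div_self hkv]; exact Complex.one_mem_slitPlane
      exact ((h1.add analyticAt_const).div_const).cexp
    · filter_upwards [hk.continuousAt.eventually_ne hkv] with z hz
      rw [← Complex.exp_nat_mul, mul_div_cancel₀ _ (Nat.cast_ne_zero.2 hn0), Complex.exp_add,
        Complex.exp_log (div_ne_zero hz hkv), Complex.exp_log hkv, div_mul_cancel₀ _ hkv]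
  set ζ : ℂ → ℂ := fun z => (z - v) * l z with hζ
  have hζa : AnalyticAt ℂ ζ v := (analyticAt_id.sub analyticAt_const).mul hl
  have hζd : HasDerivAt ζ (l v) v := by
    simpa using ((hasDerivAt_id v).sub_const v).fun_mul hl.differentiableAt.hasDerivAt
  have hζs : HasStrictDerivAt ζ (l v) v := by
    have := hζa.hasStrictDerivAt
    rwa [hζd.deriv] at this
  have hζv : ζ v = 0 := by simp [hζ]
  have hζh : ∀ᶠ z in 𝓝 v, h z - h v = ζ z ^ n := by
    filter_upwards [hfac, hlk] with z hz hz'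
    simp only [Pi.sub_apply] at hz
    rw [hz, hζ]
    simp only [mul_pow, hz', smul_eq_mul]
  have hmap := hζs.map_nhds_eq hlv
  have himg : ζ '' (A ∩ {z | h z - h v = ζ z ^ n}) ∈ 𝓝 (0 : ℂ) := by
    rw [← hζv, ← hmap]
    exact image_mem_map (inter_mem hA hζh)
  obtain ⟨ε, hε, hεs⟩ := Metric.mem_nhds_iff.1 himg
  have hprim := Complex.isPrimitiveRoot_exp n hn0
  set ω := Complex.exp (2 * Real.pi * Complex.I / n) with hω
  have hωn : ω ^ n = 1 := hprim.pow_eq_one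
  have hω1 : ω ≠ 1 := hprim.ne_one (by omega)
  have hωnorm : ‖ω‖ = 1 := hprim.norm'_eq_one hn0
  set a : ℂ := ((ε / 2 : ℝ) : ℂ) with hadef
  have hanorm : ‖a‖ = ε / 2 := by
    rw [hadef, Complex.norm_real, Real.norm_of_nonneg (by positivity)]
  -- In the coordinate `ζ` the function is a constant plus ζ^n with n ≥ 2, so the points over `a`
  -- and `a * ω` have the same value.
  obtain ⟨z₁, ⟨hz₁A, hz₁⟩, hz₁a⟩ := hεs (show a ∈ Metric.ball 0 ε by
    rw [mem_ball_zero_iff, hanorm]; linarith)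
  obtain ⟨z₂, ⟨hz₂A, hz₂⟩, hz₂a⟩ := hεs (show a * ω ∈ Metric.ball 0 ε by
    rw [mem_ball_zero_iff, norm_mul, hanorm, hωnorm]; linarith)
  rw [mem_ofPred_eq, hz₁a] at hz₁
  rw [mem_ofPred_eq, hz₂a, mul_pow, hωn, mul_one, ← hz₁] at hz₂
  have heq : z₂ = z₁ := hinj hz₂A hz₁A (sub_left_injective hz₂)
  rw [heq, hz₁a] at hz₂a
  have ha0 : a ≠ 0 := by rw [← norm_pos_iff, hanorm]; positivity
  exact hω1 (mul_left_cancel₀ ha0 (by rw [mul_one]; exact hz₂a.symm))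

/-! ### Rotations of the sphere as coordinates -/

/-- A rotation of the sphere, as a parametrization of the complement of the point `b`. -/
def rot (b u : ℂ) : RSphere :=
  open Classical in
  if u = starRingEnd ℂ b then OnePoint.infty
  else (((b * u + 1) / (u - starRingEnd ℂ b) : ℂ) : RSphere)

/-- The inverse of `rot b`, a coordinate on the complement of the point `b`. -/
def rotInv (b : ℂ) (z : RSphere) : ℂ :=
  z.elim (starRingEnd ℂ b) fun t => (starRingEnd ℂ b * t + 1) / (t - b)

theorem one_add_mul_conj_ne_zero (b : ℂ) : b * starRingEnd ℂ b + 1 ≠ 0 := by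
  rw [Complex.mul_conj]
  have : (0 : ℝ) < Complex.normSq b + 1 := by have := Complex.normSq_nonneg b; linarith
  exact_mod_cast this.ne'

theorem rot_conj (b : ℂ) : rot b (starRingEnd ℂ b) = OnePoint.infty := by simp [rot]

theorem rot_of_ne {b u : ℂ} (h : u ≠ starRingEnd ℂ b) :
    rot b u = (((b * u + 1) / (u - starRingEnd ℂ b) : ℂ) : RSphere) := by simp [rot, h]

theorem rot_ne (b u : ℂ) : rot b u ≠ (b : RSphere) := by
  by_cases h : u = starRingEnd ℂ b
  · rw [h, rot_conj]; exact OnePoint.infty_ne_coe b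
  · rw [rot_of_ne h, Ne, OnePoint.coe_eq_coe, div_eq_iff (sub_ne_zero.2 h)]
    intro h'
    exact one_add_mul_conj_ne_zero b (by linear_combination h')

theorem rotInv_rot (b u : ℂ) : rotInv b (rot b u) = u := by
  by_cases h : u = starRingEnd ℂ b
  · rw [h, rot_conj]; rfl
  · rw [rot_of_ne h]
    have h1 := sub_ne_zero.2 h
    have h2 := one_add_mul_conj_ne_zero b
    change (starRingEnd ℂ b * ((b * u + 1) / (u - starRingEnd ℂ b)) + 1) /
      ((b * u + 1) / (u - starRingEnd ℂ b) - b) = u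
    have h3 : (b * u + 1) / (u - starRingEnd ℂ b) - b =
        (b * starRingEnd ℂ b + 1) / (u - starRingEnd ℂ b) := by
      field_simp; ring
    have h4 : starRingEnd ℂ b * ((b * u + 1) / (u - starRingEnd ℂ b)) + 1 =
        u * ((b * starRingEnd ℂ b + 1) / (u - starRingEnd ℂ b)) := by
      field_simp; ring
    rw [h3, h4, mul_div_cancel_right₀ _ (div_ne_zero h2 h1)]

theorem rot_injective (b : ℂ) : Function.Injective (rot b) :=
  Function.LeftInverse.injective (rotInv_rot b)

theorem rot_rotInv {b : ℂ} {z : RSphere} (hz : z ≠ (b : RSphere)) : rot b (rotInv b z) = z := by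
  induction z using OnePoint.rec with
  | infty => exact rot_conj b
  | coe t =>
    have ht : t - b ≠ 0 := sub_ne_zero.2 fun h => hz (by rw [h])
    have h2 := one_add_mul_conj_ne_zero b
    have h1 : rotInv b (t : RSphere) - starRingEnd ℂ b =
        (b * starRingEnd ℂ b + 1) / (t - b) := by
      change (starRingEnd ℂ b * t + 1) / (t - b) - _ = _
      field_simp; ring
    have h3 : rotInv b (t : RSphere) ≠ starRingEnd ℂ b := by
      rw [← sub_ne_zero, h1]; exact div_ne_zero h2 ht
    rw [rot_of_ne h3, h1, OnePoint.coe_eq_coe]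
    change (b * ((starRingEnd ℂ b * t + 1) / (t - b)) + 1) / _ = _
    field_simp
    ring

theorem tendsto_norm_rot_atTop (b : ℂ) :
    Tendsto (fun w => ‖(b * w + 1) / (w - starRingEnd ℂ b)‖) (𝓝[≠] (starRingEnd ℂ b)) atTop := by
  simp only [div_eq_mul_inv, norm_mul, norm_inv]
  refine Tendsto.pos_mul_atTop (norm_pos_iff.2 (one_add_mul_conj_ne_zero b)) ?_ ?_
  · exact tendsto_nhdsWithin_of_tendsto_nhds (Continuous.tendsto (by fun_prop) _)
  · refine tendsto_inv_nhdsGT_zero.comp (tendsto_nhdsWithin_iff.2 ⟨?_, ?_⟩)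
    · refine tendsto_nhdsWithin_of_tendsto_nhds (Continuous.tendsto' (by fun_prop) _ _ ?_)
      simp
    · filter_upwards [self_mem_nhdsWithin] with w hw
      exact norm_pos_iff.2 (sub_ne_zero.2 hw)

theorem continuous_rot (b : ℂ) : Continuous (rot b) := by
  rw [continuous_iff_continuousAt]
  intro u
  by_cases h : u = starRingEnd ℂ b
  · subst h
    rw [continuousAt_iff_punctured_nhds, rot_conj]
    have := (OnePoint.tendsto_coe_infty (X := ℂ)).comp
      ((Filter.coclosedCompact_eq_cocompact (X := ℂ)).symm ▸ Metric.cobounded_eq_cocompact (α := ℂ) ▸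
        tendsto_norm_atTop_iff_cobounded.1 (tendsto_norm_rot_atTop b))
    refine this.congr' ?_
    filter_upwards [self_mem_nhdsWithin] with w hw
    rw [rot_of_ne hw]; rfl
  · have hev : ∀ᶠ w in 𝓝 u, w ≠ starRingEnd ℂ b := isOpen_ne.mem_nhds h
    have hc : ContinuousAt (fun w => (b * w + 1) / (w - starRingEnd ℂ b)) u := by
      refine ContinuousAt.div (by fun_prop) (by fun_prop) (sub_ne_zero.2 h)
    refine ((OnePoint.continuous_coe.continuousAt).comp hc).congr ?_
    filter_upwards [hev] with w hw
    rw [rot_of_ne hw]; rfl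

theorem continuousOn_rotInv (b : ℂ) : ContinuousOn (rotInv b) {(b : RSphere)}ᶜ := by
  intro z hz
  refine ContinuousAt.continuousWithinAt ?_
  induction z using OnePoint.rec with
  | infty =>
    rw [OnePoint.continuousAt_infty', Filter.coclosedCompact_eq_cocompact,
      ← Metric.cobounded_eq_cocompact]
    have h1 : Tendsto (fun t : ℂ => starRingEnd ℂ b + (b * starRingEnd ℂ b + 1) * (t - b)⁻¹)
        (Bornology.cobounded ℂ) (𝓝 (starRingEnd ℂ b + (b * starRingEnd ℂ b + 1) * 0)) := by
      refine tendsto_const_nhds.add (tendsto_const_nhds.mul ?_)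
      refine tendsto_inv₀_cobounded.comp ?_
      exact tendsto_sub_const_cobounded b
    rw [mul_zero, add_zero] at h1
    refine h1.congr' ?_
    have : ∀ᶠ t : ℂ in Bornology.cobounded ℂ, t ≠ b := by
      filter_upwards [Bornology.isBounded_singleton (x := b)] with t ht using ht
    filter_upwards [this] with t ht
    have ht := sub_ne_zero.2 ht
    change _ = (starRingEnd ℂ b * t + 1) / (t - b)
    field_simp; ring
  | coe t =>
    have ht : t - b ≠ 0 := sub_ne_zero.2 fun h => hz (by rw [h]; rfl)
    rw [OnePoint.continuousAt_coe]
    exact ContinuousAt.div (by fun_prop) (by fun_prop) ht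

/-! ### The curve and the charts in rotated coordinates -/

theorem exists_homCoord_rot (b u : ℂ) : ∃ c : ℂ, c ≠ 0 ∧
    b * u + 1 = c * (homCoord (rot b u)).1 ∧ u - starRingEnd ℂ b = c * (homCoord (rot b u)).2 := by
  by_cases h : u = starRingEnd ℂ b
  · subst h
    refine ⟨_, one_add_mul_conj_ne_zero b, ?_, ?_⟩ <;> rw [rot_conj] <;> simp [homCoord]
  · refine ⟨u - starRingEnd ℂ b, sub_ne_zero.2 h, ?_, ?_⟩ <;> rw [rot_of_ne h] <;>
      simp [homCoord, mul_div_cancel₀ _ (sub_ne_zero.2 h)]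

open Polynomial in
/-- The equation of the curve `P(z, w) = 0` in the coordinates `z = rot a u`, `w = rot b v`. -/
def rotPoly (P : MvPolynomial (Fin 2) ℂ) (a b : ℂ) : ℂ[X][X] :=
  ∑ m ∈ P.support, C (C (P.coeff m) * ((C a * X + 1) ^ m 0 *
      (X - C (starRingEnd ℂ a)) ^ (P.degreeOf 0 - m 0))) *
    ((C (C b) * X + 1) ^ m 1 * (X - C (C (starRingEnd ℂ b))) ^ (P.degreeOf 1 - m 1))

theorem evalEval_rotPoly (P : MvPolynomial (Fin 2) ℂ) (a b u v : ℂ) :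
    (rotPoly P a b).evalEval u v = ∑ m ∈ P.support, P.coeff m *
      ((a * u + 1) ^ m 0 * (u - starRingEnd ℂ a) ^ (P.degreeOf 0 - m 0)) *
      ((b * v + 1) ^ m 1 * (v - starRingEnd ℂ b) ^ (P.degreeOf 1 - m 1)) := by
  rw [rotPoly, Polynomial.evalEval_finsetSum]
  refine Finset.sum_congr rfl fun m _ => ?_
  simp [Polynomial.evalEval_mul, Polynomial.evalEval_pow, Polynomial.evalEval_C,
    Polynomial.evalEval_X, Polynomial.evalEval_add, Polynomial.evalEval_sub]

/-- The linear forms defining `rot` are nonzero multiples of the homogeneous coordinates;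
bihomogeneity pulls these multiples out of the equation. -/
theorem mem_curve_rot {P : MvPolynomial (Fin 2) ℂ} {a b u v : ℂ} :
    (rot a u, rot b v) ∈ curve P ↔ (rotPoly P a b).evalEval u v = 0 := by
  obtain ⟨c, hc, h1, h2⟩ := exists_homCoord_rot a u
  obtain ⟨d, hd, h3, h4⟩ := exists_homCoord_rot b v
  rw [evalEval_rotPoly, h1, h2, h3, h4]
  have : ∀ m ∈ P.support, P.coeff m *
      ((c * (homCoord (rot a u)).1) ^ m 0 *
        (c * (homCoord (rot a u)).2) ^ (P.degreeOf 0 - m 0)) *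
      ((d * (homCoord (rot b v)).1) ^ m 1 *
        (d * (homCoord (rot b v)).2) ^ (P.degreeOf 1 - m 1)) =
      c ^ P.degreeOf 0 * d ^ P.degreeOf 1 * (P.coeff m *
      ((homCoord (rot a u)).1 ^ m 0 * (homCoord (rot a u)).2 ^ (P.degreeOf 0 - m 0)) *
      ((homCoord (rot b v)).1 ^ m 1 * (homCoord (rot b v)).2 ^ (P.degreeOf 1 - m 1))) := by
    intro m hm
    have e0 : c ^ P.degreeOf 0 = c ^ m 0 * c ^ (P.degreeOf 0 - m 0) := by
      rw [← pow_add, Nat.add_sub_cancel' (MvPolynomial.monomial_le_degreeOf 0 hm)]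
    have e1 : d ^ P.degreeOf 1 = d ^ m 1 * d ^ (P.degreeOf 1 - m 1) := by
      rw [← pow_add, Nat.add_sub_cancel' (MvPolynomial.monomial_le_degreeOf 1 hm)]
    rw [e0, e1]
    ring
  rw [Finset.sum_congr rfl this, ← Finset.mul_sum, mul_eq_zero,
    or_iff_right (mul_ne_zero (pow_ne_zero _ hc) (pow_ne_zero _ hd))]
  rfl

theorem conj_conj_rsphere (z : RSphere) : conj (conj z) = z := by
  induction z using OnePoint.rec with
  | infty => rfl
  | coe t => simp [conj]

theorem conj_rot (b u : ℂ) : conj (rot b u) = rot (starRingEnd ℂ b) (starRingEnd ℂ u) := by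
  by_cases h : u = starRingEnd ℂ b
  · subst h; rw [rot_conj, rot_conj]; rfl
  · rw [rot_of_ne h, rot_of_ne fun h' => h (starRingEnd ℂ |>.injective h')]
    simp [conj]

theorem Correspondence.twist_rot (F : Correspondence) (b u : ℂ) :
    F.twist (rot b u) = rot (conjIf F.anti b) (conjIf F.anti u) := by
  unfold Correspondence.twist
  cases F.anti
  · simp [conjIf_false]
  · simp [conjIf_true, conj_rot]

theorem Correspondence.mem_graph_rot {F : Correspondence} {b u v : ℂ} :
    (rot b u, rot b v) ∈ F.graph ↔
      (rotPoly F.poly (conjIf F.anti b) b).evalEval (conjIf F.anti u) v = 0 := by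
  change (F.twist (rot b u), rot b v) ∈ curve F.poly ↔ _
  rw [F.twist_rot, mem_curve_rot]

/-- `h` is holomorphic at `t` and its derivative there has spherical norm `1`. -/
def SphericalIsometryAt (h : ℂ → ℂ) (t : ℂ) : Prop :=
  AnalyticAt ℂ h t ∧ ‖deriv h t‖ * (1 + ‖t‖ ^ 2) = 1 + ‖h t‖ ^ 2

theorem SphericalIsometryAt.congr {h k : ℂ → ℂ} {t : ℂ} (hh : SphericalIsometryAt h t)
    (e : h =ᶠ[𝓝 t] k) : SphericalIsometryAt k t := by
  refine ⟨hh.1.congr e, ?_⟩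
  rw [← e.deriv_eq, ← e.self_of_nhds]
  exact hh.2

/-- The coefficient matrix is a scalar multiple of a unitary one, so |αt + β|² + |γt + δ|² = (|α|² +
|β|²)(1 + |t|²). -/
theorem sphericalIsometryAt_mobius {α β γ δ t : ℂ} {ε : ℝ} (hn : γ * t + δ ≠ 0)
    (hε : ε ^ 2 = 1) (hγ : γ = ε * starRingEnd ℂ β) (hδ : δ = -(ε * starRingEnd ℂ α)) :
    SphericalIsometryAt (fun t => (α * t + β) / (γ * t + δ)) t := by
  constructor
  · refine AnalyticAt.div ?_ ?_ hn <;> fun_prop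
  have h1 : HasDerivAt (fun t => (α * t + β) / (γ * t + δ))
      ((α * (γ * t + δ) - (α * t + β) * γ) / (γ * t + δ) ^ 2) t := by
    have ha : HasDerivAt (fun t => α * t + β) α t := by
      simpa using ((hasDerivAt_id t).const_mul α).add_const β
    have hb : HasDerivAt (fun t => γ * t + δ) γ t := by
      simpa using ((hasDerivAt_id t).const_mul γ).add_const δ
    exact ha.fun_div hb hn
  have h2 : α * (γ * t + δ) - (α * t + β) * γ = -(ε * (‖α‖ ^ 2 + ‖β‖ ^ 2) : ℝ) := by
    push_cast
    rw [← Complex.mul_conj', ← Complex.mul_conj', hγ, hδ]; ring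
  have hε1 : ‖ε‖ = 1 := by
    rw [Real.norm_eq_abs, ← sq_eq_sq₀ (abs_nonneg _) zero_le_one, sq_abs, hε, one_pow]
  have h3 : ‖α * t + β‖ ^ 2 + ‖γ * t + δ‖ ^ 2 = (‖α‖ ^ 2 + ‖β‖ ^ 2) * (1 + ‖t‖ ^ 2) := by
    have : γ * t + δ = ε * (starRingEnd ℂ β * t - starRingEnd ℂ α) := by rw [hγ, hδ]; ring
    rw [this, norm_mul, Complex.norm_real, hε1, one_mul]
    simp only [Complex.sq_norm, Complex.normSq_apply]
    simp
    ring
  have h4 : ‖γ * t + δ‖ ^ 2 ≠ 0 := pow_ne_zero _ (norm_ne_zero_iff.2 hn)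
  rw [h1.deriv, h2, norm_div, norm_neg, Complex.norm_real, norm_mul, hε1, one_mul,
    Real.norm_of_nonneg (by positivity), norm_pow, norm_div, div_pow, div_mul_eq_mul_div, ← h3,
    add_div, div_self h4, add_comm]

theorem sphericalIsometryAt_coordAt_rot (b u : ℂ) :
    SphericalIsometryAt (fun w => coordAt (rot b u) (rot b w)) u := by
  by_cases h : u = starRingEnd ℂ b
  · have hu : b * u + 1 ≠ 0 := by rw [h]; exact one_add_mul_conj_ne_zero b
    refine SphericalIsometryAt.congr (sphericalIsometryAt_mobius (α := 1) (β := -starRingEnd ℂ b)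
      (ε := -1) hu (by norm_num) (by simp) (by simp)) (Eventually.of_forall fun w => ?_)
    rw [h, rot_conj]
    beta_reduce
    by_cases hw : w = starRingEnd ℂ b
    · rw [hw, rot_conj]; simp [coordAt]
    · rw [rot_of_ne hw]
      simp [coordAt, inv_div, sub_eq_add_neg]
  · have hu : 1 * u + -starRingEnd ℂ b ≠ 0 := by
      rw [one_mul, ← sub_eq_add_neg]; exact sub_ne_zero.2 h
    refine SphericalIsometryAt.congr (sphericalIsometryAt_mobius (α := b) (β := 1)
      (ε := 1) hu (by norm_num) (by simp) (by simp)) ?_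
    filter_upwards [isOpen_ne.mem_nhds h] with w hw
    rw [rot_of_ne h, rot_of_ne hw]
    simp [coordAt, sub_eq_add_neg]

theorem ofCoord_coordAt (a : RSphere) : ofCoord a (coordAt a a) = a := by
  induction a using OnePoint.rec with
  | infty => simp [ofCoord, coordAt]
  | coe t => simp [ofCoord, coordAt]

theorem ofCoord_infty : ofCoord OnePoint.infty = rot 0 := by
  funext t
  by_cases h : t = 0 <;> simp [ofCoord, rot, h]

theorem continuous_ofCoord (a : RSphere) : Continuous (ofCoord a) := by
  induction a using OnePoint.rec with
  | infty => rw [ofCoord_infty]; exact continuous_rot 0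
  | coe t => exact OnePoint.continuous_coe

theorem sphericalIsometryAt_rotInv_ofCoord {b : ℂ} {a : RSphere} (ha : a ≠ (b : RSphere)) :
    SphericalIsometryAt (fun t => rotInv b (ofCoord a t)) (coordAt a a) := by
  induction a using OnePoint.rec with
  | infty =>
    have hu : -b * coordAt OnePoint.infty OnePoint.infty + 1 ≠ 0 := by simp [coordAt]
    refine SphericalIsometryAt.congr (sphericalIsometryAt_mobius (α := 1) (β := starRingEnd ℂ b)
      (ε := -1) hu (by norm_num) (by simp) (by simp)) (Eventually.of_forall fun w => ?_)
    by_cases hw : w = 0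
    · simp [hw, ofCoord, rotInv]
    · simp only [ofCoord, rotInv, OnePoint.elim_infty, if_neg hw, OnePoint.elim_some]
      have h1 : starRingEnd ℂ b * w⁻¹ + 1 = (1 * w + starRingEnd ℂ b) * w⁻¹ := by
        field_simp; ring
      have h2 : w⁻¹ - b = (-b * w + 1) * w⁻¹ := by field_simp; ring
      rw [h1, h2, mul_div_mul_right _ _ (inv_ne_zero hw)]
  | coe t =>
    have ht : 1 * coordAt (t : RSphere) (t : RSphere) + -b ≠ 0 := by
      simp only [coordAt, OnePoint.elim_some, one_mul, ← sub_eq_add_neg]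
      exact sub_ne_zero.2 fun h => ha (by rw [h])
    refine SphericalIsometryAt.congr (sphericalIsometryAt_mobius (α := starRingEnd ℂ b) (β := 1)
      (ε := 1) ht (by norm_num) (by simp) (by simp)) (Eventually.of_forall fun w => ?_)
    simp [ofCoord, rotInv, sub_eq_add_neg]

theorem holomorphicCurveAt_rot {b : ℂ} {h : ℂ → ℂ} {t : ℂ} (hh : AnalyticAt ℂ h t) :
    HolomorphicCurveAt (fun s => rot b (h s)) t :=
  ⟨(continuous_rot b).continuousAt.comp hh.continuousAt,
    (sphericalIsometryAt_coordAt_rot b (h t)).1.comp hh⟩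

theorem holomorphicAt_rot {b b' : ℂ} {f : ℂ → ℂ} {u : ℂ} (hf : AnalyticAt ℂ f u) :
    HolomorphicAt (fun z => rot b' (f (rotInv b z))) (rot b u) := by
  refine holomorphicCurveAt_rot (h := fun t => f (rotInv b (ofCoord (rot b u) t))) ?_
  refine AnalyticAt.fun_comp ?_ (sphericalIsometryAt_rotInv_ofCoord (rot_ne b u)).1
  rwa [ofCoord_coordAt, rotInv_rot]

/-- Both changes between standard and rotated coordinates are spherical isometries, so spherical
derivatives may be computed in the rotated coordinate, conjugation included. -/
theorem sphericalDeriv_eq {f : RSphere → RSphere} {b u d : ℂ} {c : Bool} {σ : ℂ → ℂ}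
    (hσ : HasDerivAt (fun w => conjIf c (σ w)) d u)
    (hf : ∀ᶠ t in 𝓝 (coordAt (rot b u) (rot b u)),
      f (ofCoord (rot b u) t) = rot b (σ (rotInv b (ofCoord (rot b u) t)))) :
    sphericalDeriv f (rot b u) = ‖d‖ * (1 + ‖u‖ ^ 2) / (1 + ‖σ u‖ ^ 2) := by
  have hfu : f (rot b u) = rot b (σ u) := by
    have := hf.self_of_nhds
    rwa [ofCoord_coordAt, rotInv_rot] at this
  obtain ⟨hψ, hψn⟩ := sphericalIsometryAt_rotInv_ofCoord (rot_ne b u)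
  obtain ⟨hχ, hχn⟩ := sphericalIsometryAt_coordAt_rot b (σ u)
  simp only [ofCoord_coordAt, rotInv_rot] at hψn
  set t₀ := coordAt (rot b u) (rot b u)
  set ψ := fun t => rotInv b (ofCoord (rot b u) t) with hψdef
  set χ := fun w => coordAt (rot b (σ u)) (rot b w) with hχdef
  have hψ0 : ψ t₀ = u := by simp only [hψdef, t₀, ofCoord_coordAt, rotInv_rot]
  have hrep : localRep f (rot b u) =ᶠ[𝓝 t₀] fun t => χ (σ (ψ t)) := by
    filter_upwards [hf] with t ht
    rw [localRep, hfu, ht]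
  obtain ⟨J, hJ, hJn⟩ : ∃ J : ℂ →L[ℝ] ℂ, (∀ w, J w = conjIf c w) ∧ ∀ w, ‖J w‖ = ‖w‖ := by
    cases c
    · exact ⟨ContinuousLinearMap.id ℝ ℂ, fun w => by simp [conjIf_false], fun w => by simp⟩
    · exact ⟨Complex.conjCLE.toContinuousLinearMap, fun w => by simp [conjIf_true],
        fun w => by simp⟩
  have h1 : HasFDerivAt σ (J.comp ((ContinuousLinearMap.toSpanSingleton ℂ d).restrictScalars ℝ))
      u := by
    have := (J.hasFDerivAt (x := conjIf c (σ u))).comp u (hσ.hasFDerivAt.restrictScalars ℝ)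
    refine this.congr_of_eventuallyEq (Eventually.of_forall fun w => ?_)
    simp only [Function.comp, hJ]
    exact (conjIf_involutive c (σ w)).symm
  have hψd := hψ.differentiableAt.hasDerivAt.hasFDerivAt.restrictScalars ℝ
  have hχd := hχ.differentiableAt.hasDerivAt.hasFDerivAt.restrictScalars ℝ
  rw [← hψ0] at h1 hχd
  have h2 := (hχd.comp t₀ (h1.comp t₀ hψd)).congr_of_eventuallyEq hrep
  rw [sphericalDeriv, h2.fderiv, hfu,
    ContinuousLinearMap.homothety_norm (a := ‖deriv χ (σ u)‖ * (‖d‖ * ‖deriv ψ t₀‖)),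
    div_eq_div_iff (by positivity) (by positivity)]
  · change _ * (1 + ‖t₀‖ ^ 2) * _ = ‖d‖ * _ * (1 + ‖χ (σ u)‖ ^ 2)
    rw [← hχn, ← hψn]; ring
  · intro w
    simp [hJn, hψ0]
    ring

/-! ### From the correspondence to its plane model -/

namespace Correspondence

variable {F : Correspondence} {S : Set RSphere}

theorem inverseMap_spec {w : RSphere} (hw : w ∈ F.image S) :
    F.inverseMap S w ∈ S ∧ (F.inverseMap S w, w) ∈ F.graph := by
  rw [inverseMap, dif_pos hw]
  exact hw.choose_spec

theorem InvariantlyInverseLike.eq_inverseMap (hF : F.InvariantlyInverseLike S) {z w : RSphere}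
    (hz : z ∈ S) (hzw : (z, w) ∈ F.graph) : z = F.inverseMap S w :=
  (hF.2 w ⟨z, hz, hzw⟩).unique ⟨hz, hzw⟩ (inverseMap_spec ⟨z, hz, hzw⟩)

end Correspondence

theorem exists_coe_notMem {S : Set RSphere} (hclosed : IsClosed S) (hproper : S ≠ univ) :
    ∃ b : ℂ, (b : RSphere) ∉ S := by
  obtain ⟨b, hb⟩ := (OnePoint.denseRange_coe (X := ℂ)).exists_mem_open hclosed.isOpen_compl
    (nonempty_compl.2 hproper)
  exact ⟨b, hb⟩

namespace PlanarSystem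

/-- `G` is the inverse map of the correspondence `F` on `S` in the coordinate `rot b`. -/
structure Models (G : PlanarSystem) (F : Correspondence) (S : Set RSphere) (b : ℂ) : Prop where
  anti : G.anti = F.anti
  notMem : (b : RSphere) ∉ S
  image_subset : F.image S ⊆ S
  mem_K : ∀ u, u ∈ G.K ↔ rot b u ∈ S
  mem_L : ∀ u, u ∈ G.L ↔ rot b u ∈ F.image S
  rot_g : ∀ u ∈ G.L, rot b (G.g u) = F.inverseMap S (rot b u)
  mem_graph : ∀ u ∈ G.K, ∀ v, (rot b u, rot b v) ∈ F.graph ↔ v ∈ G.L ∧ G.g v = u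

theorem exists_models {F : Correspondence} {S : Set RSphere} (hclosed : IsClosed S)
    (hproper : S ≠ univ) (hne : S.Nonempty) (hF : F.InvariantlyInverseLike S) :
    ∃ (b : ℂ) (G : PlanarSystem), G.Models F S b := by
  obtain ⟨b, hb⟩ := exists_coe_notMem hclosed hproper
  have hSb : ∀ z ∈ S, z ≠ (b : RSphere) := fun z hz h => hb (h ▸ hz)
  have hrr : ∀ z ∈ S, rot b (rotInv b z) = z := fun z hz => rot_rotInv (hSb z hz)
  set K := rot b ⁻¹' S with hK
  set L := rot b ⁻¹' F.image S with hL
  set g : ℂ → ℂ := fun u => rotInv b (F.inverseMap S (rot b u)) with hg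
  have hrotg : ∀ v ∈ L, rot b (g v) = F.inverseMap S (rot b v) := fun v hv =>
    hrr _ (Correspondence.inverseMap_spec hv).1
  have hKc : IsCompact K := by
    have : K = rotInv b '' S := by
      ext u
      constructor
      · exact fun hu => ⟨_, hu, rotInv_rot b u⟩
      · rintro ⟨z, hz, rfl⟩
        rw [hK, mem_preimage, hrr z hz]; exact hz
    rw [this]
    exact hclosed.isCompact.image_of_continuousOn
      ((continuousOn_rotInv b).mono fun z hz => hSb z hz)
  have hLK : L ⊆ K := preimage_mono hF.1
  have hgr : ∀ u ∈ K, ∀ v, (rot b u, rot b v) ∈ F.graph → v ∈ L ∧ g v = u := by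
    intro u hu v huv
    refine ⟨⟨_, hu, huv⟩, ?_⟩
    rw [hg]
    simp only
    rw [← hF.eq_inverseMap hu huv, rotInv_rot]
  have hgr' : ∀ v ∈ L, g v ∈ K ∧ (rot b (g v), rot b v) ∈ F.graph := by
    intro v hv
    rw [hK, mem_preimage, hrotg v hv]
    exact Correspondence.inverseMap_spec hv
  obtain ⟨G, hG1, hG2, hG3, hG4⟩ := exists_planarSystem (b := F.anti)
    (p := rotPoly F.poly (conjIf F.anti b) b) (K := K) (L := L) (g := g) hKc
    (by
      obtain ⟨z, hz⟩ := hne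
      exact ⟨rotInv b z, by rw [hK, mem_preimage, hrr z hz]; exact hz⟩)
    (by
      intro v
      simp only [← Correspondence.mem_graph_rot]
      constructor
      · intro hv
        exact ⟨g v, hgr' v hv⟩
      · rintro ⟨u, hu, huv⟩
        exact (hgr u hu v huv).1)
    hLK
    (by
      intro v hv
      rw [← Correspondence.mem_graph_rot]
      exact hgr' v hv)
    (by
      intro u hu v huv
      rw [← Correspondence.mem_graph_rot] at huv
      exact (hgr u hu v huv).2.symm)
    (by
      intro u hu
      by_contra! hcon
      simp only [← Correspondence.mem_graph_rot] at hcon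
      have : K = univ := eq_univ_of_forall fun v => hLK (hgr u hu v (hcon v)).1
      -- A vertical line inside the curve would force K to be the whole plane.
      exact noncompact_univ ℂ (this ▸ hKc))
  clear_value K L g
  subst hG2 hG3 hG4
  refine ⟨b, G, hG1, hb, hF.1, fun u => ?_, fun u => ?_, hrotg, fun u hu v => ⟨hgr u hu v, ?_⟩⟩
  · rw [hK]; rfl
  · rw [hL]; rfl
  · rintro ⟨hv, rfl⟩
    exact (hgr' v hv).2

variable {G : PlanarSystem}

theorem mem_fib_succ {k : ℕ} {u v : ℂ} :
    v ∈ G.fib (k + 1) u ↔ v ∈ G.L ∧ G.g v ∈ G.fib k u := by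
  simp only [fib, dom, mem_ofPred_eq, Function.iterate_succ_apply]
  constructor
  · rintro ⟨⟨-, h2⟩, h3⟩
    have hL := h2 0 (by omega)
    exact ⟨hL, ⟨G.mapsTo hL, fun i hi => h2 (i + 1) (by omega)⟩, h3⟩
  · rintro ⟨hL, ⟨-, h2⟩, h3⟩
    refine ⟨⟨G.L_subset hL, fun i hi => ?_⟩, h3⟩
    cases i with
    | zero => exact hL
    | succ i => exact h2 i (by omega)

namespace Models

variable {F : Correspondence} {S : Set RSphere} {b : ℂ} (hM : G.Models F S b)

include hM

theorem rot_rotInv {z : RSphere} (hz : z ∈ S) : rot b (rotInv b z) = z :=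
  HolCorr.rot_rotInv fun h => hM.notMem (h ▸ hz)

theorem iter_rot {u : ℂ} (hu : u ∈ G.K) (k : ℕ) : F.iter k (rot b u) = rot b '' G.fib k u := by
  induction k with
  | zero =>
    have : G.fib 0 u = {u} := by
      ext v
      simp only [fib, dom, mem_ofPred_eq, mem_singleton_iff, Function.iterate_zero_apply]
      constructor
      · exact fun h => h.2
      · rintro rfl; exact ⟨⟨hu, fun i hi => by omega⟩, rfl⟩
    rw [this, image_singleton]; rfl
  | succ k ih =>
    rw [Correspondence.iter, Function.iterate_succ_apply', ← Correspondence.iter, ih]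
    ext w
    constructor
    · rintro ⟨_, ⟨v, hv, rfl⟩, hw⟩
      have hwS := hM.image_subset ⟨_, (hM.mem_K v).1 hv.1.1, hw⟩
      rw [← hM.rot_rotInv hwS] at hw ⊢
      obtain ⟨h1, h2⟩ := (hM.mem_graph v hv.1.1 _).1 hw
      exact ⟨_, mem_fib_succ.2 ⟨h1, h2 ▸ hv⟩, rfl⟩
    · rintro ⟨v, hv, rfl⟩
      obtain ⟨h1, h2⟩ := mem_fib_succ.1 hv
      exact ⟨_, ⟨_, h2, rfl⟩, (hM.mem_graph _ (G.mapsTo h1) _).2 ⟨h1, rfl⟩⟩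

theorem rot_iterate {v : ℂ} {k : ℕ} (hv : ∀ i < k, (F.inverseMap S)^[i] (rot b v) ∈ F.image S) :
    rot b (G.g^[k] v) = (F.inverseMap S)^[k] (rot b v) := by
  induction k with
  | zero => rfl
  | succ k ih =>
    have ih := ih fun i hi => hv i (by omega)
    rw [Function.iterate_succ_apply', Function.iterate_succ_apply', hM.rot_g, ih]
    rw [hM.mem_L, ih]
    exact hv k (by omega)

theorem exists_isBasin {n : ℕ} {z x : RSphere} (hz : F.IsAttractingPeriodic S n z)
    (hx : x ∈ F.immediateBasin S n z) :
    ∃ p V, G.IsBasin n p V ∧ rotInv b x ∈ V ∧ rot b (rotInv b x) = x := by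
  simp only [Correspondence.immediateBasin, Correspondence.basinComponent, mem_iUnion,
    mem_sUnion] at hx
  obtain ⟨j, -, V, ⟨hVo, hVc, hjV, hVb⟩, hxV⟩ := hx
  set q := (F.inverseMap S)^[j] z with hq
  have hVS : V ⊆ S := fun v hv => hM.image_subset ((hVb hv).1 0)
  have hrr : ∀ v ∈ V, rot b (rotInv b v) = v := fun v hv => hM.rot_rotInv (hVS hv)
  have hit : ∀ v ∈ rot b ⁻¹' V, ∀ k, rot b (G.g^[k] v) = (F.inverseMap S)^[k] (rot b v) :=
    fun v hv k => hM.rot_iterate fun i _ => (hVb hv).1 i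
  have hpV : rotInv b q ∈ rot b ⁻¹' V := by rw [mem_preimage, hrr q hjV]; exact hjV
  have hbV : V ⊆ {(b : RSphere)}ᶜ := fun v hv h => hM.notMem (hVS (h ▸ hv))
  refine ⟨rotInv b q, rot b ⁻¹' V, ⟨hz.pos, hVo.preimage (continuous_rot b), ?_, hpV, ?_, ?_, ?_⟩,
    ?_, hrr x hxV⟩
  · have : rot b ⁻¹' V = rotInv b '' V := by
      ext u
      constructor
      · exact fun hu => ⟨_, hu, rotInv_rot b u⟩
      · rintro ⟨v, hv, rfl⟩
        rw [mem_preimage, hrr v hv]; exact hv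
    rw [this]
    exact hVc.isPreconnected.image _ ((continuousOn_rotInv b).mono hbV)
  · intro k v hv
    refine ⟨(hM.mem_K v).2 (hVS hv), fun i _ => ?_⟩
    rw [hM.mem_L, hit v hv]
    exact (hVb hv).1 i
  · refine rot_injective b ?_
    rw [hit _ hpV, hrr q hjV]
    exact hz.periodic.apply_iterate j
  · intro v hv
    have h1 : ∀ k, (G.g^[n])^[k] v = rotInv b (((F.inverseMap S)^[n])^[k] (rot b v)) := by
      intro k
      rw [← Function.iterate_mul, ← Function.iterate_mul, ← hit v hv, rotInv_rot]
    simp only [h1]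
    have hc : ContinuousAt (rotInv b) q :=
      (continuousOn_rotInv b).continuousAt (isOpen_compl_singleton.mem_nhds (hbV hjV))
    exact hc.tendsto.comp (hVb hv).2
  · rw [mem_preimage, hrr x hxV]; exact hxV

/-- The graph of g near `v`, parametrized by its second coordinate, is a local component of the
curve; its first projection is not injective because the derivative vanishes. -/
theorem rot_mem_criticalValuesInv {v : ℂ} (hv : v ∈ interior G.L)
    (hd : deriv (fun w => conjIf G.anti (G.g w)) v = 0) :
    rot b (G.g v) ∈ F.criticalValuesInv := by
  set h : ℂ → ℂ := fun w => conjIf G.anti (G.g w) with hh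
  have htw : ∀ w, F.twist (rot b (G.g w)) = rot (conjIf F.anti b) (h w) := fun w => by
    rw [F.twist_rot, hh, hM.anti]
  have hha : AnalyticAt ℂ h v := by
    rw [Complex.analyticAt_iff_eventually_differentiableAt]
    filter_upwards [isOpen_interior.mem_nhds hv] with w hw using G.differentiableAt w hw
  have hha' : AnalyticAt ℂ (fun t => h (v + t)) 0 := by
    refine AnalyticAt.fun_comp (by simpa using hha) ?_
    fun_prop
  refine ⟨rot b v, fun t => (rot (conjIf F.anti b) (h (v + t)), rot b (v + t)),
    ⟨?_, holomorphicCurveAt_rot hha', holomorphicCurveAt_rot (by fun_prop), ?_, univ, univ_mem, ?_⟩,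
    fun V hV hinj => ?_⟩
  · rw [htw]; simp
  · have : ∀ᶠ t in 𝓝 (0 : ℂ), v + t ∈ interior G.L := by
      refine (Continuous.tendsto' (by fun_prop) _ _ (add_zero v)).eventually
        (isOpen_interior.mem_nhds hv)
    filter_upwards [this] with t ht
    rw [← htw]
    have ht := interior_subset ht
    exact (hM.mem_graph _ (G.mapsTo ht) _).2 ⟨ht, rfl⟩
  · intro s _ t _ hst
    simpa using rot_injective b (Prod.ext_iff.1 hst).2
  · refine deriv_ne_zero_of_injOn hha' hV (fun s hs t ht hst => hinj hs ht ?_) ?_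
    · exact congrArg (rot _) hst
    · rw [deriv_comp_const_add, add_zero]; exact hd

/-- Applying g is a particular choice of F⁻¹, so forward orbits of critical values of g stay in the
postcritical set. -/
theorem rotInv_notMem_closure_orb {u : ℂ} (hu : rot b u ∉ F.postcriticalInv) :
    u ∉ closure G.orb := by
  intro hmem
  refine hu ?_
  have h1 := image_closure_subset_closure_image (continuous_rot b) (mem_image_of_mem (rot b) hmem)
  refine closure_mono ?_ h1
  rintro _ ⟨y, ⟨i, v, hv, hvi, hv0, rfl⟩, rfl⟩
  refine mem_iUnion.2 ⟨i, ?_⟩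
  have key : ∀ j ≤ i, rot b (G.g^[j + 1] v) ∈ F.preimage^[j] F.criticalValuesInv := by
    intro j
    induction j with
    | zero => exact fun _ => hM.rot_mem_criticalValuesInv hvi hv0
    | succ j ih =>
      intro hj
      rw [Function.iterate_succ_apply' (f := F.preimage), Function.iterate_succ_apply' (f := G.g)]
      have hL : G.g^[j + 1] v ∈ G.L := hv.2 _ (by omega)
      exact ⟨_, ih (by omega), (hM.mem_graph _ (G.mapsTo hL) _).2 ⟨hL, rfl⟩⟩
  exact key i le_rfl

end Models

end PlanarSystem

/-! ### Branches of the iterates and the critical exponent -/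

theorem continuous_conj : Continuous conj :=
  (Complex.conjCLE.toHomeomorph.onePointCongr).continuous

theorem isOpen_image_rot {b : ℂ} {U : Set ℂ} (hU : IsOpen U) : IsOpen (rot b '' U) := by
  have : rot b '' U = {(b : RSphere)}ᶜ ∩ rotInv b ⁻¹' U := by
    ext z
    constructor
    · rintro ⟨u, hu, rfl⟩
      exact ⟨rot_ne b u, by rwa [mem_preimage, rotInv_rot]⟩
    · rintro ⟨h1, h2⟩
      exact ⟨_, h2, rot_rotInv h1⟩
  rw [this]
  exact (continuousOn_rotInv b).isOpen_inter_preimage isOpen_compl_singleton hU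

theorem Correspondence.RegularOn.continuousAt {F : Correspondence} {k : ℕ} {f : RSphere → RSphere}
    {U : Set RSphere} (h : F.RegularOn k f U) {a : RSphere} (ha : a ∈ U) :
    ContinuousAt (fun t => f (ofCoord a t)) (coordAt a a) := by
  have := h a ha
  split_ifs at this
  · have := continuous_conj.continuousAt.comp this.1
    simpa only [Function.comp_def, conj_conj_rsphere] using this
  · exact this.1

namespace PlanarSystem

theorem tw_eq_conjIf (G : PlanarSystem) (k : ℕ) :
    G.tw k = conjIf (G.anti && decide (Odd k)) := by
  induction k with
  | zero => rw [tw]; simp [conjIf_false]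
  | succ k ih =>
    rw [tw, Function.iterate_succ', ← tw, ih]
    cases h : G.anti
    · rfl
    · by_cases hk : Odd k
      · have : ¬ Odd (k + 1) := by rw [Nat.odd_add_one]; exact not_not.2 hk
        funext z
        simp [hk, this, conjIf]
      · have : Odd (k + 1) := by rw [Nat.odd_add_one]; exact hk
        funext z
        simp [hk, this, conjIf]

variable {G : PlanarSystem} {F : Correspondence} {S : Set RSphere} {b : ℂ}

/-- The absolute value of the derivative in the spherical metric of the branch of the inverse of
`g^k` which takes the value `v` at `u`. -/
def sphereWt (G : PlanarSystem) (k : ℕ) (u v : ℂ) : ℝ :=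
  G.wt k v * (1 + ‖u‖ ^ 2) / (1 + ‖v‖ ^ 2)

namespace IsSection

variable {k : ℕ} {U : Set ℂ} {σ : ℂ → ℂ}

theorem sphericalDeriv_eq (hU : IsOpen U) (hB : U ⊆ interior G.K \ G.orb)
    (h : G.IsSection k U σ) {u : ℂ} (hu : u ∈ U) {f : RSphere → RSphere}
    (hf : ∀ᶠ t in 𝓝 (coordAt (rot b u) (rot b u)),
      f (ofCoord (rot b u) t) = rot b (σ (rotInv b (ofCoord (rot b u) t)))) :
    sphericalDeriv f (rot b u) = G.sphereWt k u (σ u) := by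
  have h1 := h.hasDerivAt hU hB hu
  have h2 := h.norm_deriv hU hB hu
  rw [h1.deriv] at h2
  rw [G.tw_eq_conjIf k] at h1
  rw [HolCorr.sphericalDeriv_eq h1 hf, ← G.tw_eq_conjIf k, h2, sphereWt]

theorem regularOn (hM : G.Models F S b) (hU : IsOpen U) (hB : U ⊆ interior G.K \ G.orb)
    (h : G.IsSection k U σ) :
    F.RegularOn k (fun z => rot b (σ (rotInv b z))) (rot b '' U) := by
  rintro _ ⟨u, hu, rfl⟩
  have ha : AnalyticAt ℂ (fun w => G.tw k (σ w)) u := by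
    rw [Complex.analyticAt_iff_eventually_differentiableAt]
    filter_upwards [hU.mem_nhds hu] with w hw using (h.hasDerivAt hU hB hw).differentiableAt
  rw [G.tw_eq_conjIf k, hM.anti] at ha
  split_ifs with hc
  · rw [AntiholomorphicAt]
    simp only [conj_rot]
    refine holomorphicAt_rot (f := fun w => starRingEnd ℂ (σ w)) ?_
    simpa [hc.1, hc.2, conjIf_true] using ha
  · refine holomorphicAt_rot ?_
    have : (F.anti && decide (Odd k)) = false := by
      simpa using hc
    simpa [this, conjIf_false] using ha

end IsSection

theorem sphereWt_le (k : ℕ) (u v : ℂ) :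
    G.sphereWt k u v ≤ (1 + ‖u‖ ^ 2) * G.wt k v := by
  rw [sphereWt, mul_comm (G.wt k v)]
  refine div_le_self (mul_nonneg (by positivity) (wt_nonneg k v)) ?_
  linarith [sq_nonneg ‖v‖]

/-- Square summability bounds all weights, so with spherical weights at most `D`, (a/D)^s ≥ a/D for
s < 1 reduces the claim to the bound for first powers. -/
theorem IsBasin.exists_le_tsum_rpow {N : ℕ} {p x : ℂ} {V : Set ℂ}
    (hV : G.IsBasin N p V) (hx : x ∈ V \ closure G.orb) {s : ℝ} (hs : 0 < s) (hs1 : s < 1) :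
    ∃ c > 0, ∀ m, ENNReal.ofReal c ≤
      ∑' v : G.fib (N * m) x, ENNReal.ofReal (G.sphereWt (N * m) x v) ^ s := by
  obtain ⟨c, hc, hcm⟩ := hV.exists_le_wtSum hx
  obtain ⟨R, hR⟩ := G.isCompact_K.isBounded.exists_norm_le
  set T := (∑' k, ∑' v : G.fib k x, ENNReal.ofReal (G.wt k v) ^ 2).toReal with hT
  have hwt : ∀ k, ∀ v ∈ G.fib k x, G.wt k v ≤ T + 1 := by
    intro k v hv
    have h1 : ENNReal.ofReal (G.wt k v) ^ 2 ≤
        ∑' k, ∑' v : G.fib k x, ENNReal.ofReal (G.wt k v) ^ 2 :=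
      (ENNReal.le_tsum (f := fun v : G.fib k x => ENNReal.ofReal (G.wt k v) ^ 2) ⟨v, hv⟩).trans
        (ENNReal.le_tsum (f := fun k => ∑' v : G.fib k x, ENNReal.ofReal (G.wt k v) ^ 2) k)
    rw [← ENNReal.ofReal_pow (wt_nonneg k v),
      ENNReal.ofReal_le_iff_le_toReal (hV.tsum_wt_sq_lt_top hx).ne, ← hT] at h1
    nlinarith [wt_nonneg (G := G) k v, sq_nonneg (G.wt k v - 1)]
  set D := (1 + ‖x‖ ^ 2) * (T + 1) with hD
  have hT0 : 0 ≤ T := ENNReal.toReal_nonneg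
  have hD0 : 0 < D := by positivity
  have key : ∀ k, ∀ v ∈ G.fib k x,
      D ^ s / D / (1 + R ^ 2) * G.wt k v ≤ G.sphereWt k x v ^ s := by
    intro k v hv
    have hw0 := wt_nonneg (G := G) k v
    have ha0 : 0 ≤ G.sphereWt k x v := by unfold sphereWt; positivity
    have haD : G.sphereWt k x v ≤ D :=
      (sphereWt_le k x v).trans (mul_le_mul_of_nonneg_left (hwt k v hv) (by positivity))
    have h1 : G.wt k v / (1 + R ^ 2) ≤ G.sphereWt k x v := by
      have hvR := hR v hv.1.1
      unfold sphereWt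
      refine div_le_div₀ (by positivity) ?_ (by positivity) (by gcongr)
      nlinarith [sq_nonneg ‖x‖]
    calc D ^ s / D / (1 + R ^ 2) * G.wt k v = D ^ s * (G.wt k v / (1 + R ^ 2) / D) := by ring
      _ ≤ D ^ s * (G.sphereWt k x v / D) := by gcongr
      _ = D ^ s * (G.sphereWt k x v / D) ^ (1 : ℝ) := by rw [Real.rpow_one]
      _ ≤ D ^ s * (G.sphereWt k x v / D) ^ s := by
        refine mul_le_mul_of_nonneg_left ?_ (by positivity)
        exact Real.rpow_le_rpow_of_exponent_ge' (by positivity) ((div_le_one hD0).2 haD) hs.le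
          hs1.le
      _ = G.sphereWt k x v ^ s := by
        rw [← Real.mul_rpow hD0.le (by positivity), mul_div_cancel₀ _ hD0.ne']
  refine ⟨D ^ s / D / (1 + R ^ 2) * c, by positivity, fun m => ?_⟩
  have : Fintype (G.fib (N * m) x) := (G.finite_fib (N * m) x).fintype
  calc ENNReal.ofReal (D ^ s / D / (1 + R ^ 2) * c)
      ≤ ENNReal.ofReal (D ^ s / D / (1 + R ^ 2) * G.wtSum (N * m) x) := by
        gcongr
        exact hcm m
    _ = ENNReal.ofReal (∑ v : G.fib (N * m) x, D ^ s / D / (1 + R ^ 2) * G.wt (N * m) v) := by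
        rw [wtSum, ← Finset.mul_sum]
        congr 2
        exact (Finset.sum_subtype _ (fun v => (G.finite_fib (N * m) x).mem_toFinset) _)
    _ = ∑ v : G.fib (N * m) x, ENNReal.ofReal (D ^ s / D / (1 + R ^ 2) * G.wt (N * m) v) := by
        refine ENNReal.ofReal_sum_of_nonneg fun v _ => ?_
        have := wt_nonneg (G := G) (N * m) v
        positivity
    _ ≤ _ := by
        rw [tsum_fintype]
        refine Finset.sum_le_sum fun v _ => ?_
        have hw0 := wt_nonneg (G := G) (N * m) v
        have ha0 : 0 ≤ G.sphereWt (N * m) x v := by unfold sphereWt; positivity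
        rw [ENNReal.ofReal_rpow_of_nonneg ha0 hs.le]
        exact ENNReal.ofReal_le_ofReal (key _ v v.2)

namespace Models

variable (hM : G.Models F S b)

include hM

open Metric in
-- Branches are indexed by the fibre over the centre: each section over the disc is determined by
-- its value there.
theorem exists_branches {c : ℂ} {r : ℝ} (hr : 0 < r) (hB : ball c r ⊆ interior G.K \ G.orb)
    (k : ℕ) : ∃ (B : F.Branches k (rot b '' ball c r)) (e : Fin B.M ≃ G.fib k c),
      ∀ j, sphericalDeriv (B.f j) (rot b c) = G.sphereWt k c (e j) := by
  have hc : c ∈ ball c r := mem_ball_self hr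
  have : Finite (G.fib k c) := G.finite_fib k c
  have := Fintype.ofFinite (G.fib k c)
  let e := (Fintype.equivFin (G.fib k c)).symm
  choose σ hσ hσc _ using fun j => exists_section hB hc (e j).2
  refine ⟨⟨_, fun j z => rot b (σ j (rotInv b z)), fun j => (hσ j).regularOn hM isOpen_ball hB,
    ?_, ?_⟩, e, fun j => ?_⟩
  · rintro _ ⟨u, hu, rfl⟩
    rw [hM.iter_rot (interior_subset (hB hu).1)]
    simp only [rotInv_rot]
    ext w
    constructor
    · rintro ⟨v, hv, rfl⟩
      obtain ⟨τ, hτ, rfl, -⟩ := exists_section hB hu hv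
      obtain ⟨j, hj⟩ := e.surjective ⟨τ c, hτ.2 c hc⟩
      refine ⟨j, ?_⟩
      have : σ j c = τ c := by rw [hσc, hj]
      simp only
      rw [(hσ j).eqOn hB hτ hc this hu]
    · rintro ⟨j, rfl⟩
      exact ⟨_, (hσ j).2 u hu, rfl⟩
  · intro i j hij
    have := hij (mem_image_of_mem (rot b) hc)
    simp only [rotInv_rot] at this
    have := rot_injective b this
    rw [hσc, hσc] at this
    exact e.injective (Subtype.ext this)
  · rw [(hσ j).sphericalDeriv_eq isOpen_ball hB hc (Eventually.of_forall fun t => rfl), hσc]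

theorem criticalExponent_le {N : ℕ} {p x : ℂ} {V : Set ℂ} (hV : G.IsBasin N p V)
    (hx : x ∈ V \ closure G.orb) : F.criticalExponent (rot b x) ≤ 2 := by
  refine sInf_le ⟨2, by norm_num, ?_, by simp⟩
  obtain ⟨r, hr, hrV⟩ := Metric.isOpen_iff.1 hV.isOpen_diff x hx
  choose B e hBe using hM.exists_branches hr (hrV.trans hV.diff_subset)
  rw [Correspondence.poincareSeries]
  refine (iInf₂_le_of_le (rot b '' Metric.ball x r) ⟨isOpen_image_rot Metric.isOpen_ball,
    (Metric.isConnected_ball hr).image _ (continuous_rot b).continuousOn,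
    mem_image_of_mem _ (Metric.mem_ball_self hr)⟩ (iInf_le _ B)).trans_lt ?_
  have h1 : ∀ k, ∑ j, ENNReal.ofReal (sphericalDeriv ((B k).f j) (rot b x)) ^ (2 : ℝ) ≤
      ENNReal.ofReal (1 + ‖x‖ ^ 2) ^ 2 * ∑' v : G.fib k x, ENNReal.ofReal (G.wt k v) ^ 2 := by
    intro k
    rw [← ENNReal.tsum_mul_left, ← (e k).tsum_eq, tsum_fintype]
    refine Finset.sum_le_sum fun j _ => ?_
    rw [ENNReal.rpow_two, ← mul_pow, ← ENNReal.ofReal_mul (by positivity), hBe]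
    gcongr
    exact sphereWt_le k x _
  refine (ENNReal.tsum_le_tsum h1).trans_lt ?_
  rw [ENNReal.tsum_mul_left]
  exact ENNReal.mul_lt_top (by finiteness) (hV.tsum_wt_sq_lt_top hx)

/-- An arbitrary branch of `F^k` has the expected derivative. -/
theorem sphericalDeriv_branch {k : ℕ} {U : Set RSphere} (hU : IsOpen U) (B : F.Branches k U)
    (j : Fin B.M) {u v : ℂ} (huU : rot b u ∈ U) {W : Set ℂ} (hW : IsOpen W) (huW : u ∈ W)
    (hWK : W ⊆ interior G.K \ G.orb) (hv : B.f j (rot b u) = rot b v) :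
    v ∈ G.fib k u ∧ sphericalDeriv (B.f j) (rot b u) = G.sphereWt k u v := by
  set t₀ := coordAt (rot b u) (rot b u)
  have hfib : ∀ y ∈ W, rot b y ∈ U → ∀ w, B.f j (rot b y) = rot b w → w ∈ G.fib k y := by
    intro y hy hyU w hw
    have h1 : rot b w ∈ F.iter k (rot b y) := by
      rw [B.iter_eq _ hyU, ← hw]; exact mem_range_self j
    rw [hM.iter_rot (interior_subset (hWK hy).1)] at h1
    obtain ⟨w', hw', he⟩ := h1
    rwa [← rot_injective b he]
  have hvf := hfib u huW huU v hv
  refine ⟨hvf, ?_⟩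
  obtain ⟨r, hr, hrW⟩ := Metric.isOpen_iff.1 hW u huW
  have huB := Metric.mem_ball_self (x := u) hr
  obtain ⟨σ, hσ, hσu, -⟩ := exists_section (hrW.trans hWK) huB hvf
  -- Near `v` the map g^k is injective, so the given branch and the section through `v`, both
  -- continuous inverses of g^k, agree near `u`.
  obtain ⟨φ, hφv, hφs, hφ⟩ := exists_openPartialHomeomorph hvf.1 (by rw [hvf.2]; exact (hWK huW).1)
    (by rw [hvf.2]; exact (hWK huW).2)
  rw [hσ.sphericalDeriv_eq (f := B.f j) (b := b) Metric.isOpen_ball (hrW.trans hWK) huB, hσu]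
  have hψ := (sphericalIsometryAt_rotInv_ofCoord (rot_ne b u)).1.continuousAt
  have hψ0 : rotInv b (ofCoord (rot b u) t₀) = u := by rw [ofCoord_coordAt, rotInv_rot]
  have hc := (continuous_ofCoord (rot b u)).continuousAt (x := t₀)
  have hν : ContinuousAt (fun t => rotInv b (B.f j (ofCoord (rot b u) t))) t₀ := by
    refine ContinuousAt.comp (g := rotInv b) ?_ ((B.regular j).continuousAt huU)
    rw [ofCoord_coordAt, hv]
    exact (continuousOn_rotInv b).continuousAt (isOpen_compl_singleton.mem_nhds (rot_ne b v))
  have hσψ : ContinuousAt (fun t => σ (rotInv b (ofCoord (rot b u) t))) t₀ := by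
    refine ContinuousAt.comp (g := σ) ?_ hψ
    rw [hψ0]
    exact hσ.1.continuousAt (Metric.isOpen_ball.mem_nhds huB)
  have hψB : ∀ᶠ t in 𝓝 t₀, rotInv b (ofCoord (rot b u) t) ∈ Metric.ball u r :=
    hψ.eventually_mem (Metric.isOpen_ball.mem_nhds (by rwa [hψ0]))
  filter_upwards [hψB,
    hc.eventually_mem (isOpen_compl_singleton.mem_nhds
      (by rw [ofCoord_coordAt]; exact rot_ne b u)),
    hc.eventually_mem (hU.mem_nhds (by rwa [ofCoord_coordAt])),
    hν.eventually_mem (φ.open_source.mem_nhds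
      (by rwa [ofCoord_coordAt, hv, rotInv_rot])),
    hσψ.eventually_mem (φ.open_source.mem_nhds (by rwa [hψ0, hσu]))] with t h1 h2 h3 h4 h5
  have h6 := HolCorr.rot_rotInv h2
  set y := rotInv b (ofCoord (rot b u) t)
  rw [← h6] at h3 h4 ⊢
  obtain ⟨w, hw⟩ : ∃ w, B.f j (rot b y) = rot b w := by
    have h7 : B.f j (rot b y) ∈ F.iter k (rot b y) := by
      rw [B.iter_eq _ h3]; exact mem_range_self j
    rw [hM.iter_rot (interior_subset (hWK (hrW h1)).1)] at h7
    obtain ⟨w, -, hw⟩ := h7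
    exact ⟨w, hw.symm⟩
  have hwf := hfib y (hrW h1) h3 w hw
  rw [hw, rotInv_rot] at h4
  rw [hw, φ.injOn h4 h5 (by rw [hφ, hwf.2, (hσ.2 y h1).2])]

/-- The Poincaré series is an infimum over all choices of branches, so divergence must be shown for
an arbitrary choice. Selecting one branch for each fibre point gives the inequality needed. -/
theorem tsum_fib_le_sum_branches {k : ℕ} {U : Set RSphere} (hU : IsOpen U) (B : F.Branches k U)
    {u : ℂ} (huU : rot b u ∈ U) {W : Set ℂ} (hW : IsOpen W) (huW : u ∈ W)
    (hWK : W ⊆ interior G.K \ G.orb) (s : ℝ) :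
    ∑' v : G.fib k u, ENNReal.ofReal (G.sphereWt k u v) ^ s ≤
      ∑ j, ENNReal.ofReal (sphericalDeriv (B.f j) (rot b u)) ^ s := by
  have h1 : ∀ v : G.fib k u, ∃ j, B.f j (rot b u) = rot b v := by
    intro v
    have : rot b v ∈ F.iter k (rot b u) := by
      rw [hM.iter_rot (interior_subset (hWK huW).1)]
      exact mem_image_of_mem _ v.2
    rw [B.iter_eq _ huU] at this
    exact this
  choose j hj using h1
  have hinj : Function.Injective j := by
    intro v w h
    refine Subtype.ext (rot_injective b ?_)
    rw [← hj, ← hj, h]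
  rw [← tsum_fintype (L := .unconditional _)]
  refine le_trans (le_of_eq ?_) (ENNReal.tsum_comp_le_tsum_of_injective hinj _)
  refine tsum_congr fun v => ?_
  rw [(hM.sphericalDeriv_branch hU B (j v) huU hW huW hWK (hj v)).2]

theorem le_criticalExponent {N : ℕ} {p x : ℂ} {V : Set ℂ} (hV : G.IsBasin N p V)
    (hx : x ∈ V \ closure G.orb) : 1 ≤ F.criticalExponent (rot b x) := by
  refine le_sInf ?_
  rintro _ ⟨s, hs, hlt, rfl⟩
  rw [← ENNReal.ofReal_one]
  refine ENNReal.ofReal_le_ofReal ?_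
  by_contra! hs1
  simp only [Correspondence.poincareSeries, iInf_lt_iff] at hlt
  obtain ⟨U, ⟨hU, -, hxU⟩, B, hB⟩ := hlt
  obtain ⟨c, hc, hcm⟩ := hV.exists_le_tsum_rpow hx hs hs1
  refine hB.ne (top_unique ?_)
  -- The uniform lower bound holds only at multiples of the period; these levels alone already make
  -- the series diverge.
  have hinj : Function.Injective fun m => N * m := fun a b h => Nat.eq_of_mul_eq_mul_left hV.pos h
  refine le_trans ?_ (ENNReal.tsum_comp_le_tsum_of_injective hinj _)
  rw [← ENNReal.tsum_const_eq_top_of_ne_zero (α := ℕ) (ENNReal.ofReal_pos.2 hc).ne']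
  exact ENNReal.tsum_le_tsum fun m => (hcm m).trans
    (hM.tsum_fib_le_sum_branches hU (B _) hxU hV.isOpen_diff hx hV.diff_subset s)

end Models

end PlanarSystem

end HolCorr

end

theorem mainTheorem8 (F : HolCorr.Correspondence) (S : Set HolCorr.RSphere)
    (hclosed : IsClosed S) (hproper : S ≠ Set.univ) (hF : F.InvariantlyInverseLike S)
    (n : ℕ) (z : HolCorr.RSphere) (hz : F.IsAttractingPeriodic S n z)
    (x : HolCorr.RSphere) (hx : x ∈ F.immediateBasin S n z \ F.postcriticalInv) :
    1 ≤ F.criticalExponent x ∧ F.criticalExponent x ≤ 2 := by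
  have hne : S.Nonempty := ⟨_, hF.1 (interior_subset (hz.mem_interior 0))⟩
  obtain ⟨b, G, hM⟩ := HolCorr.PlanarSystem.exists_models hclosed hproper hne hF
  obtain ⟨p, V, hV, hxV, hbx⟩ := hM.exists_isBasin hz hx.1
  have hx' := hx.2
  rw [← hbx] at hx' ⊢
  have hmem := And.intro hxV (hM.rotInv_notMem_closure_orb hx')
  exact ⟨hM.le_criticalExponent hV hmem, hM.criticalExponent_le hV hmem⟩
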